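/- Consider an urn with $K$ colors, on some probability space. Its composition vectors $C_n=(C_{n1},\dots,C_{nK})$ have total content $S_n=\sum_i C_{ni}$ and evolve, for $n\ge 1$, by $C_n=C_{n-1}+\chi_n R_n$, where $R_n$ is a random $K\times K$ matrix with nonnegative entries and the random row vector $\chi_n$ takes values in the set of coordinate vectors $e_1,\dots,e_K$ of $\mathbb R^K$ ($\chi_n=e_i$ means that color $i$ is drawn in the $n$-th trial). Let $N_n=\sum_{k=1}^n\chi_k$ be the count vector, and let $\mathcal F_n$ be the $\sigma$-field generated by $C_0$ and $(R_m,\chi_m)_{1\le m\le n}$. For a $K\times K$ matrix $A$ put $\|A\|=\max_i\sum_j|A_{ij}|$. Assume: (1) $C_0$ is nonzero with nonnegative entries and has finite mean; for all $n\ge1$ and all $i$, $P(\chi_n=e_i\mid\mathcal F_{n-1})=C_{n-1,i}/S_{n-1}$ almost surely; and for all $n\ge 1$, $\chi_n$ and $R_n$ are conditionally independent given $\mathcal F_{n-1}$. (2) There are $c\in(0,\infty)$ and a positive random variable $R$ (possibly on another probability space) with $E(R)<\infty$ and $E(R\log_+R)<\infty$ such that $P(\|R_n\|>x)\le c\,P(R>x)$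 for all $n\ge1$ and all $x>0$. (3) There is a (possibly random) matrix $H$ with nonnegative entries which is almost surely irreducible (for all $i,j$ there is an integer $N\ge1$ with $(H^N)_{ij}>0$) such that the generating matrices $H_n=E(R_{n+1}\mid\mathcal F_n)$ satisfy $$\frac1n\sum_{k=0}^{n-1}\|H_k-H\|\to0\quad\text{almost surely.}$$ Let $\lambda_H$ be the dominant eigenvalue of $H$, that is, its eigenvalue with the largest real part. Then almost surely $H$ has a unique left eigenvector $\pi_H$ for $\lambda_H$ that has strictly positive coordinates and is a probability vector, and $$\frac{C_n}{S_n}\to\pi_H,\qquad \frac{S_n}{n}\to\lambda_H,\qquad \frac{C_n}{n}\to\lambda_H\pi_H,\qquad \frac{N_n}{n}\to\pi_H$$ hold both almost surely and in $L^1$. -/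

import Mathlib

open MeasureTheory ProbabilityTheory Filter Topology

noncomputable section

namespace Urn

/-- The Borel (product) σ-field on real matrices. -/
instance instMeasurableSpaceMatrix (m n : Type*) : MeasurableSpace (Matrix m n ℝ) :=
  inferInstanceAs (MeasurableSpace (m → n → ℝ))

/-! ### Matrices -/

/-- The norm `max_i ∑_j |A i j|` of a square matrix. -/
def rowNorm {K : ℕ} (A : Matrix (Fin K) (Fin K) ℝ) : ℝ :=
  ⨆ i, ∑ j, |A i j|

/-- The dominant eigenvalue: the largest real part of a complex eigenvalue. (For an irreducible
matrix with nonnegative entries this number is itself an eigenvalue.) -/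
def domEigenvalue {K : ℕ} (A : Matrix (Fin K) (Fin K) ℝ) : ℝ :=
  sSup (Complex.re '' spectrum ℂ (A.map Complex.ofReal))

/-- `v` is a left eigenvector of `A` for the dominant eigenvalue, has strictly positive coordinates
and is a probability vector. -/
structure IsPerronVector {K : ℕ} (A : Matrix (Fin K) (Fin K) ℝ) (v : Fin K → ℝ) : Prop where
  pos : ∀ i, 0 < v i
  sum_eq_one : ∑ i, v i = 1
  left_eigen : Matrix.vecMul v A = domEigenvalue A • v

open Classical in
/-- The normalized positive left eigenvector for the dominant eigenvalue (`0` if there is none,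
which does not happen for irreducible matrices with nonnegative entries, of size at least one). -/
def perronVector {K : ℕ} (A : Matrix (Fin K) (Fin K) ℝ) : Fin K → ℝ :=
  if h : ∃ v, IsPerronVector A v then h.choose else 0

/-! ### The urn process

`C₀` is the initial composition. For `n ≥ 1`, `R n` is the replacement matrix and `J n` is the color
drawn in the `n`-th trial; the values `R 0` and `J 0` are never used. -/

variable {Ω : Type*} {K : ℕ}

/-- The indicator (coordinate) vector `χₙ` of the color drawn in the `n`-th trial. -/
def chi (J : ℕ → Ω → Fin K) (n : ℕ) (ω : Ω) : Fin K → ℝ :=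
  Pi.single (J n ω) 1

/-- The composition vector `Cₙ`: `Cₙ₊₁ = Cₙ + χₙ₊₁ Rₙ₊₁`. -/
def comp (C₀ : Ω → Fin K → ℝ) (R : ℕ → Ω → Matrix (Fin K) (Fin K) ℝ) (J : ℕ → Ω → Fin K) :
    ℕ → Ω → Fin K → ℝ
  | 0 => C₀
  | n + 1 => fun ω => comp C₀ R J n ω + Matrix.vecMul (chi J (n + 1) ω) (R (n + 1) ω)

/-- The total content `Sₙ` of the urn. -/
def total (C₀ : Ω → Fin K → ℝ) (R : ℕ → Ω → Matrix (Fin K) (Fin K) ℝ) (J : ℕ → Ω → Fin K)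
    (n : ℕ) (ω : Ω) : ℝ :=
  ∑ i, comp C₀ R J n ω i

/-- The count vector `Nₙ = χ₁ + ⋯ + χₙ`. -/
def count (J : ℕ → Ω → Fin K) (n : ℕ) (ω : Ω) : Fin K → ℝ :=
  ∑ k ∈ Finset.Icc 1 n, chi J k ω

/-- The σ-field `ℱₙ` generated by `C₀` and `(R_m, χ_m)`, `1 ≤ m ≤ n`. -/
def past (C₀ : Ω → Fin K → ℝ) (R : ℕ → Ω → Matrix (Fin K) (Fin K) ℝ) (J : ℕ → Ω → Fin K)
    (n : ℕ) : MeasurableSpace Ω :=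
  MeasurableSpace.comap C₀ inferInstance ⊔
    ⨆ m ∈ Set.Icc 1 n,
      (MeasurableSpace.comap (R m) inferInstance ⊔ MeasurableSpace.comap (chi J m) inferInstance)

/-- Conditional independence of `X` and `Y` given the σ-field `m`. (Mathlib's `CondIndepFun` asks
for a standard Borel sample space.) -/
def CondIndepGiven [MeasurableSpace Ω] (P : Measure Ω) (m : MeasurableSpace Ω)
    {α β : Type*} [MeasurableSpace α] [MeasurableSpace β] (X : Ω → α) (Y : Ω → β) : Prop :=
  ∀ (A : Set α) (B : Set β), MeasurableSet A → MeasurableSet B →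
    P⟦X ⁻¹' A ∩ Y ⁻¹' B | m⟧ =ᵐ[P] P⟦X ⁻¹' A | m⟧ * P⟦Y ⁻¹' B | m⟧

/-- The randomized urn model with its basic assumptions. -/
structure IsUrn [MeasurableSpace Ω] (P : Measure Ω) (C₀ : Ω → Fin K → ℝ)
    (R : ℕ → Ω → Matrix (Fin K) (Fin K) ℝ) (J : ℕ → Ω → Fin K) : Prop where
  measurable_init : Measurable C₀
  measurable_repl : ∀ n, 1 ≤ n → Measurable (R n)
  measurable_draw : ∀ n, 1 ≤ n → Measurable (J n)
  repl_nonneg : ∀ n, 1 ≤ n → ∀ᵐ ω ∂P, ∀ i j, 0 ≤ R n ω i j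
  init_ne_zero : ∀ᵐ ω ∂P, C₀ ω ≠ 0
  init_nonneg : ∀ᵐ ω ∂P, ∀ i, 0 ≤ C₀ ω i
  init_integrable : Integrable C₀ P
  draw_prob : ∀ n i, P⟦{ω | chi J (n + 1) ω = Pi.single i 1} | past C₀ R J n⟧
    =ᵐ[P] fun ω => comp C₀ R J n ω i / total C₀ R J n ω
  condIndep : ∀ n, CondIndepGiven P (past C₀ R J n) (chi J (n + 1)) (R (n + 1))

/-- The generating matrix `Hₙ = E[Rₙ₊₁ | ℱₙ]` (entrywise conditional expectation). -/
def genMatrix [MeasurableSpace Ω] (P : Measure Ω) (C₀ : Ω → Fin K → ℝ)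
    (R : ℕ → Ω → Matrix (Fin K) (Fin K) ℝ) (J : ℕ → Ω → Fin K) (n : ℕ) (ω : Ω) :
    Matrix (Fin K) (Fin K) ℝ :=
  Matrix.of fun i j => (P[fun ω' => R (n + 1) ω' i j | past C₀ R J n]) ω

/-- `Xₙ → Y` almost surely and in `L¹`. -/
structure TendstoASL1 [MeasurableSpace Ω] {E : Type*} [NormedAddCommGroup E] (P : Measure Ω)
    (X : ℕ → Ω → E) (Y : Ω → E) : Prop where
  ae_tendsto : ∀ᵐ ω ∂P, Tendsto (fun n => X n ω) atTop (𝓝 (Y ω))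
  memLp : ∀ n, MemLp (X n) 1 P
  memLp_limit : MemLp Y 1 P
  tendsto_L1 : Tendsto (fun n => eLpNorm (X n - Y) 1 P) atTop (𝓝 0)

end Urn

end

/-! Let x_k = C_k/S_k. Conditional independence gives E(χ_{k+1}R_{k+1} | ℱ_k) = x_k H_k
(`IsUrn.condExp_vecMul`), and a strong law for centered increments (`ae_tendsto_average_centered`)
shows that C_n/n and the average of x_k H_k over k < n have the same limit behaviour. That law
truncates the k-th increment at k + 1: the truncated parts form an L²-bounded martingale, while the
remainders and their conditional means are controlled in weighted L¹, which is where the L log L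
bound enters. Since the x_k are probability vectors, the Cesàro hypothesis replaces H_k by H.

From there on everything is deterministic along a fixed path, so H need not be adapted. Put b_n =
x_0 + ... + x_{n-1} and A = H(ω). Then C_n = b_n A + o(n) and b_{n+1} = b_n + C_n/S_n: the averages,
rather than the proportions themselves, solve a stochastic-approximation recursion whose error
merely has to tend to 0. With p, v the left and right Perron vectors and r the eigenvalue, z_n =
b_n/(b_n·v) - p stays in the hyperplane z·v = 0 and has drift zA - rz. There ∑ (v_j/p_j) z_j² is a
Lyapunov function with a spectral gap (`PerronData.exists_gap`), and the steps are of order 1/n,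
hence not summable. So z_n → 0, b_n/n → p, C_n/n → pA = rp and x_n → p
(`PerronData.tendsto_proportions`).

Convergence in L¹ follows from boundedness for the proportions and counts, and for C_n/n from
uniform integrability of averages of a tail-dominated sequence. -/

namespace Urn

/-! ### Perron–Frobenius theory of irreducible matrices -/

section Perron

variable {ι : Type*} [Fintype ι]

open Matrix Finset

/-- An irreducible matrix may be periodic, so no single power need be positive. A sum over enough
powers is, and it still commutes with A. -/
theorem exists_sum_pow_pos [DecidableEq ι] {A : Matrix ι ι ℝ} (hA : A.IsIrreducible) :
    ∃ N : ℕ, ∀ i j, 0 < (∑ k ∈ range N, A ^ k) i j := by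
  choose f _ hf using (isIrreducible_iff_exists_pow_pos hA.nonneg).1 hA
  refine ⟨(univ.sup fun p : ι × ι => f p.1 p.2) + 1, fun i j => ?_⟩
  rw [Matrix.sum_apply]
  refine sum_pos' (fun k _ => pow_apply_nonneg hA.nonneg k i j) ⟨f i j, ?_, hf i j⟩
  exact mem_range.2 (Nat.lt_succ_of_le (le_sup (f := fun p : ι × ι => f p.1 p.2) (mem_univ (i, j))))

theorem mulVec_pos_of_pos {B : Matrix ι ι ℝ} (hB : ∀ i j, 0 < B i j) {w : ι → ℝ}
    (hw : ∀ i, 0 ≤ w i) (hw0 : w ≠ 0) (i : ι) : 0 < (B *ᵥ w) i := by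
  obtain ⟨j, hj⟩ := Function.ne_iff.1 hw0
  exact sum_pos' (fun k _ => mul_nonneg (hB i k).le (hw k))
    ⟨j, mem_univ _, mul_pos (hB i j) (lt_of_le_of_ne (hw j) (Ne.symm hj))⟩

theorem isCompact_collatzWielandt (A : Matrix ι ι ℝ) (T : ℝ) :
    IsCompact {p : ℝ × (ι → ℝ) | p.1 ∈ Set.Icc 0 T ∧ p.2 ∈ stdSimplex ℝ ι ∧
      ∀ i, p.1 * p.2 i ≤ (A *ᵥ p.2) i} := by
  have h1 : IsCompact (Set.Icc (0 : ℝ) T ×ˢ stdSimplex ℝ ι) :=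
    isCompact_Icc.prod (isCompact_stdSimplex ℝ ι)
  have h2 : IsClosed {p : ℝ × (ι → ℝ) | ∀ i, p.1 * p.2 i ≤ (A *ᵥ p.2) i} := by
    simp only [Set.ofPred_forall]
    refine isClosed_iInter fun i => isClosed_le (by fun_prop) ?_
    simp only [mulVec, dotProduct]
    fun_prop
  convert h1.inter_right h2 using 1
  ext p
  simp [and_assoc]

/-- Collatz–Wielandt argument: choose the largest r for which some x in the simplex satisfies rx ≤
Ax, which exists by compactness. If Ax ≠ rx, applying the positive matrix B = ∑ A^k makes the
inequality strict in every coordinate, and r could be increased. -/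
theorem exists_pos_right_eigenvector [DecidableEq ι] [Nonempty ι] {A : Matrix ι ι ℝ} (hA : A.IsIrreducible) :
    ∃ (r : ℝ) (x : ι → ℝ), 0 < r ∧ (∀ i, 0 < x i) ∧ A *ᵥ x = r • x := by
  obtain ⟨N, hB⟩ := exists_sum_pow_pos hA
  set B := ∑ k ∈ range N, A ^ k with hBdef
  have hcomm : A * B = B * A := by
    simp [hBdef, mul_sum, sum_mul, ← pow_succ, ← pow_succ']
  set T := ∑ i, ∑ j, A i j
  set S := {p : ℝ × (ι → ℝ) | p.1 ∈ Set.Icc 0 T ∧ p.2 ∈ stdSimplex ℝ ι ∧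
      ∀ i, p.1 * p.2 i ≤ (A *ᵥ p.2) i} with hS
  have hbound : ∀ (t : ℝ) (x : ι → ℝ), x ∈ stdSimplex ℝ ι →
      (∀ i, t * x i ≤ (A *ᵥ x) i) → t ≤ T := by
    intro t x hx h
    calc t = ∑ i, t * x i := by rw [← mul_sum, hx.2, mul_one]
      _ ≤ ∑ i, (A *ᵥ x) i := sum_le_sum fun i _ => h i
      _ ≤ T := by
        refine sum_le_sum fun i _ => sum_le_sum fun j _ => ?_
        refine mul_le_of_le_one_right (hA.nonneg i j) ?_
        rw [← hx.2]
        exact single_le_sum (fun k _ => hx.1 k) (mem_univ j)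
  have hT : 0 ≤ T := sum_nonneg fun i _ => sum_nonneg fun j _ => hA.nonneg i j
  have hne : S.Nonempty := by
    obtain ⟨i⟩ := ‹Nonempty ι›
    refine ⟨(0, Pi.single i 1), ⟨le_rfl, hT⟩, single_mem_stdSimplex ℝ i, fun j => ?_⟩
    simp only [zero_mul]
    refine sum_nonneg fun k _ => mul_nonneg (hA.nonneg _ _) ?_
    exact (single_mem_stdSimplex ℝ i).1 k
  obtain ⟨⟨r, x⟩, ⟨hr, hx, hrx⟩, hmax⟩ :=
    (isCompact_collatzWielandt A T).exists_isMaxOn hne continuous_fst.continuousOn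
  have hx0 : x ≠ 0 := by
    rintro rfl
    simpa using hx.2
  have heig : A *ᵥ x = r • x := by
    by_contra hcon
    set w := A *ᵥ x - r • x with hw
    have hw0 : w ≠ 0 := sub_ne_zero.2 hcon
    have hwn : ∀ i, 0 ≤ w i := fun i => by simpa [hw] using hrx i
    have hBw := mulVec_pos_of_pos hB hwn hw0
    have hy := mulVec_pos_of_pos hB hx.1 hx0
    set y := B *ᵥ x with hydef
    have hAy : A *ᵥ y - r • y = B *ᵥ w := by
      rw [hw, mulVec_sub, mulVec_smul, hydef, mulVec_mulVec, mulVec_mulVec, hcomm]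
    -- The smallest ratio is the largest ε with εy ≤ Bw, that is, with (r + ε)y ≤ Ay.
    obtain ⟨i₀, hi₀⟩ := Finite.exists_min fun i => (B *ᵥ w) i / y i
    set ε := (B *ᵥ w) i₀ / y i₀
    have hε : 0 < ε := div_pos (hBw _) (hy _)
    have hys : 0 < ∑ i, y i := sum_pos (fun i _ => hy i) univ_nonempty
    have hmem : (∑ i, y i)⁻¹ • y ∈ stdSimplex ℝ ι := by
      refine ⟨fun i => mul_nonneg (inv_nonneg.2 hys.le) (hy i).le, ?_⟩
      simp only [Pi.smul_apply, smul_eq_mul]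
      rw [← mul_sum, inv_mul_cancel₀ hys.ne']
    have hle : ∀ i, (r + ε) * ((∑ i, y i)⁻¹ • y) i ≤ (A *ᵥ ((∑ i, y i)⁻¹ • y)) i := by
      intro i
      rw [mulVec_smul]
      simp only [Pi.smul_apply, smul_eq_mul]
      have h1 : ε * y i ≤ (B *ᵥ w) i := (le_div_iff₀ (hy i)).1 (hi₀ i)
      have h2 : (A *ᵥ y) i - r * y i = (B *ᵥ w) i := by
        rw [← hAy]; simp
      rw [mul_left_comm]
      exact mul_le_mul_of_nonneg_left (by linarith) (inv_nonneg.2 hys.le)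
    have := hmax (show (r + ε, (∑ i, y i)⁻¹ • y) ∈ S from
      ⟨⟨by linarith [hr.1], hbound _ _ hmem hle⟩, hmem, hle⟩)
    simp only [Set.mem_ofPred_eq] at this
    linarith
  have hpow : ∀ k : ℕ, (A ^ k) *ᵥ x = r ^ k • x := by
    intro k
    induction k with
    | zero => simp
    | succ k ih => rw [pow_succ, ← mulVec_mulVec, heig, mulVec_smul, ih, smul_smul, pow_succ']
  have hxpos : ∀ i, 0 < x i := by
    intro i
    have h1 := mulVec_pos_of_pos hB hx.1 hx0 i
    have h2 : B *ᵥ x = (∑ k ∈ range N, r ^ k) • x := by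
      rw [hBdef, sum_mulVec, sum_smul]
      exact sum_congr rfl fun k _ => hpow k
    rw [h2] at h1
    refine lt_of_le_of_ne (hx.1 i) fun h => ?_
    simp [← h] at h1
  -- If r were 0, every positive power of A would kill the positive vector x, although some such
  -- power has a positive diagonal entry.
  refine ⟨r, x, lt_of_le_of_ne hr.1 fun h => ?_, hxpos, heig⟩
  obtain ⟨i⟩ := ‹Nonempty ι›
  obtain ⟨k, hk, hki⟩ := (isIrreducible_iff_exists_pow_pos hA.nonneg).1 hA i i
  have h1 := congrFun (hpow k) i
  rw [← h, zero_pow hk.ne', zero_smul] at h1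
  have h2 : 0 < ((A ^ k) *ᵥ x) i :=
    sum_pos' (fun j _ => mul_nonneg (pow_apply_nonneg hA.nonneg k i j) (hxpos j).le)
      ⟨i, mem_univ _, mul_pos hki (hxpos i)⟩
  rw [h1] at h2
  simp at h2

/-- Left and right Perron eigenvectors `p`, `v` of a nonnegative matrix, normalized by `∑ p = 1`
and `∑ p v = 1`, for the eigenvalue `r`. -/
structure PerronData (A : Matrix ι ι ℝ) (r : ℝ) (p v : ι → ℝ) : Prop where
  irr : A.IsIrreducible
  r_pos : 0 < r
  p_pos : ∀ i, 0 < p i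
  v_pos : ∀ i, 0 < v i
  p_sum : ∑ i, p i = 1
  pv_sum : ∑ i, p i * v i = 1
  left : ∀ j, ∑ i, p i * A i j = r * p j
  right : ∀ i, ∑ j, A i j * v j = r * v i

theorem exists_perronData [DecidableEq ι] [Nonempty ι] {A : Matrix ι ι ℝ} (hA : A.IsIrreducible) :
    ∃ r p v, PerronData A r p v := by
  obtain ⟨r, v, hr, hv, hAv⟩ := exists_pos_right_eigenvector hA
  obtain ⟨s, p, hs, hp, hAp⟩ := exists_pos_right_eigenvector hA.transpose
  rw [mulVec_transpose] at hAp
  have hps : 0 < ∑ i, p i := sum_pos (fun i _ => hp i) univ_nonempty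
  have hpv : 0 < p ⬝ᵥ v := sum_pos (fun i _ => mul_pos (hp i) (hv i)) univ_nonempty
  -- Evaluating p·Av from both sides gives r(p·v) = s(p·v), with p·v > 0.
  have hrs : s = r := by
    have h := dotProduct_mulVec p A v
    rw [hAv, hAp, dotProduct_smul, smul_dotProduct, smul_eq_mul, smul_eq_mul] at h
    exact (mul_right_cancel₀ hpv.ne' h).symm
  subst hrs
  refine ⟨s, fun i => p i / ∑ i, p i, fun i => v i * (∑ i, p i) / (p ⬝ᵥ v), hA, hr,
    fun i => div_pos (hp i) hps, fun i => div_pos (mul_pos (hv i) hps) hpv, ?_, ?_, ?_, ?_⟩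
  · rw [← sum_div, div_self hps.ne']
  · have : ∀ i, p i / (∑ i, p i) * (v i * (∑ i, p i) / (p ⬝ᵥ v)) = p i * v i / (p ⬝ᵥ v) := by
      intro i; field_simp
    simp only [this]
    rw [← sum_div]
    exact div_self hpv.ne'
  · intro j
    have h := congrFun hAp j
    simp only [vecMul, dotProduct, Pi.smul_apply, smul_eq_mul] at h
    rw [← mul_div_assoc, ← h, sum_div]
    exact sum_congr rfl fun i _ => by ring
  · intro i
    have h := congrFun hAv i
    simp only [mulVec, dotProduct, Pi.smul_apply, smul_eq_mul] at h
    calc _ = (∑ j, A i j * v j) * (∑ i, p i) / (p ⬝ᵥ v) := by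
          rw [sum_mul, sum_div]; exact sum_congr rfl fun j _ => by ring
      _ = _ := by rw [h]; ring

namespace PerronData

variable {A : Matrix ι ι ℝ} {r : ℝ} {p v : ι → ℝ}

/-- The Dirichlet form of a matrix is a weighted sum of squares. -/
theorem dirichlet_eq (h : PerronData A r p v) (z : ι → ℝ) :
    r * ∑ j, v j / p j * z j ^ 2 - ∑ j, v j / p j * z j * ∑ i, z i * A i j =
      (∑ i, ∑ j, p i * A i j * v j * (z i / p i - z j / p j) ^ 2) / 2 := by
  have e1 : ∑ i, ∑ j, p i * A i j * v j * (z i / p i) ^ 2 = r * ∑ j, v j / p j * z j ^ 2 := by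
    rw [mul_sum]
    refine sum_congr rfl fun i _ => ?_
    have hp := (h.p_pos i).ne'
    calc _ = p i * (z i / p i) ^ 2 * ∑ j, A i j * v j := by
          rw [mul_sum]; exact sum_congr rfl fun j _ => by ring
      _ = _ := by rw [h.right]; field_simp
  have e2 : ∑ i, ∑ j, p i * A i j * v j * (z j / p j) ^ 2 = r * ∑ j, v j / p j * z j ^ 2 := by
    rw [sum_comm, mul_sum]
    refine sum_congr rfl fun j _ => ?_
    have hp := (h.p_pos j).ne'
    calc _ = v j * (z j / p j) ^ 2 * ∑ i, p i * A i j := by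
          rw [mul_sum]; exact sum_congr rfl fun j _ => by ring
      _ = _ := by rw [h.left]; field_simp
  have e3 : ∑ i, ∑ j, p i * A i j * v j * (z i / p i * (z j / p j)) =
      ∑ j, v j / p j * z j * ∑ i, z i * A i j := by
    rw [sum_comm]
    refine sum_congr rfl fun j _ => ?_
    rw [mul_sum]
    refine sum_congr rfl fun i _ => ?_
    have hp := (h.p_pos j).ne'
    have hp := (h.p_pos i).ne'
    field_simp
  have e4 : ∑ i, ∑ j, p i * A i j * v j * (z i / p i - z j / p j) ^ 2 =
      ∑ i, ∑ j, p i * A i j * v j * (z i / p i) ^ 2 +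
      ∑ i, ∑ j, p i * A i j * v j * (z j / p j) ^ 2 -
      2 * ∑ i, ∑ j, p i * A i j * v j * (z i / p i * (z j / p j)) := by
    simp only [mul_sum, ← sum_add_distrib, ← sum_sub_distrib]
    exact sum_congr rfl fun i _ => sum_congr rfl fun j _ => by ring
  rw [e4, e1, e2, e3]; ring

/-- A sum of nonnegative squares that is at most 0 vanishes term by term, so z/p agrees across each
edge i → j with A i j > 0. Irreducibility connects any two indices by a path of such edges. -/
theorem ratio_eq_of_dirichlet_eq_zero (h : PerronData A r p v) {z : ι → ℝ}
    (hz : r * ∑ j, v j / p j * z j ^ 2 - ∑ j, v j / p j * z j * ∑ i, z i * A i j ≤ 0) (i j : ι) :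
    z i / p i = z j / p j := by
  rw [h.dirichlet_eq] at hz
  have hnn : ∀ i j, 0 ≤ p i * A i j * v j * (z i / p i - z j / p j) ^ 2 := fun i j =>
    mul_nonneg (mul_nonneg (mul_nonneg (h.p_pos i).le (h.irr.nonneg i j)) (h.v_pos j).le)
      (sq_nonneg _)
  have h0 : ∑ i, ∑ j, p i * A i j * v j * (z i / p i - z j / p j) ^ 2 = 0 :=
    le_antisymm (by linarith) (sum_nonneg fun i _ => sum_nonneg fun j _ => hnn i j)
  have h1 : ∀ i j, 0 < A i j → z i / p i = z j / p j := by
    intro i j hij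
    have h2 := (sum_eq_zero_iff_of_nonneg fun i _ => sum_nonneg fun j _ => hnn i j).1 h0 i
      (mem_univ i)
    have h3 := (sum_eq_zero_iff_of_nonneg fun j _ => hnn i j).1 h2 j (mem_univ j)
    have h4 := (mul_pos (mul_pos (h.p_pos i) hij) (h.v_pos j)).ne'
    exact sub_eq_zero.1 (by simpa [h4] using h3)
  let := toQuiver A
  obtain ⟨q, -⟩ := h.irr.connected i j
  induction q with
  | nil => rfl
  | cons _ e ih => exact ih.trans (h1 _ _ e.down)

/-- A spectral gap for the Dirichlet form on the complement of the Perron direction. -/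
theorem exists_gap (h : PerronData A r p v) :
    ∃ κ, 0 < κ ∧ ∀ z : ι → ℝ, ∑ i, z i * v i = 0 →
      ∑ j, v j / p j * z j * ∑ i, z i * A i j ≤ (r - κ) * ∑ j, v j / p j * z j ^ 2 := by
  set V : (ι → ℝ) → ℝ := fun z => ∑ j, v j / p j * z j ^ 2 with hV
  set D : (ι → ℝ) → ℝ := fun z => r * V z - ∑ j, v j / p j * z j * ∑ i, z i * A i j with hD
  have hDc : Continuous D := by simp only [hD, hV]; fun_prop
  have hVc : Continuous V := by simp only [hV]; fun_prop
  have hw : ∀ j, 0 < v j / p j := fun j => div_pos (h.v_pos j) (h.p_pos j)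
  have hVpos : ∀ z, z ≠ 0 → 0 < V z := by
    intro z hz
    obtain ⟨j, hj⟩ := Function.ne_iff.1 hz
    exact sum_pos' (fun k _ => mul_nonneg (hw k).le (sq_nonneg _))
      ⟨j, mem_univ _, mul_pos (hw j) (pow_pos (abs_pos.2 hj) 2 |>.trans_eq (sq_abs _))⟩
  set S := Metric.sphere (0 : ι → ℝ) 1 ∩ {z | ∑ i, z i * v i = 0} with hS
  have hSc : IsCompact S := (isCompact_sphere 0 1).inter_right
    (isClosed_eq (by fun_prop) continuous_const)
  have hS0 : ∀ z ∈ S, z ≠ 0 := by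
    rintro z hz rfl
    simpa using hz.1
  have hDpos : ∀ z ∈ S, 0 < D z := by
    intro z hz
    by_contra hcon
    have hrat := h.ratio_eq_of_dirichlet_eq_zero (z := z) (not_lt.1 hcon)
    obtain ⟨i, hi⟩ := Function.ne_iff.1 (hS0 z hz)
    have hzj : ∀ j, z j = z i / p i * p j := fun j => by
      rw [hrat i j, div_mul_cancel₀ _ (h.p_pos j).ne']
    have h1 : ∑ j, z j * v j = z i / p i := by
      calc _ = z i / p i * ∑ j, p j * v j := by
            rw [mul_sum]; exact sum_congr rfl fun j _ => by rw [hzj j]; ring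
        _ = _ := by rw [h.pv_sum, mul_one]
    have h2 : z i / p i = 0 := h1.symm.trans hz.2
    exact hi (by simpa [(h.p_pos i).ne'] using h2)
  have key : ∃ κ, 0 < κ ∧ ∀ z ∈ S, κ * V z ≤ D z := by
    -- With a single index the hyperplane is {0} and `S` is empty. Otherwise κ is the minimum of D/V
    -- on the compact set `S`, and homogeneity of degree 2 extends the bound to the hyperplane.
    rcases S.eq_empty_or_nonempty with he | hne
    · exact ⟨1, one_pos, by simp [he]⟩
    · obtain ⟨z₀, hz₀, hmin⟩ := hSc.exists_isMinOn hne
        (hDc.continuousOn.div hVc.continuousOn fun z hz => (hVpos z (hS0 z hz)).ne')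
      refine ⟨D z₀ / V z₀, div_pos (hDpos _ hz₀) (hVpos _ (hS0 _ hz₀)), fun z hz => ?_⟩
      exact (le_div_iff₀ (hVpos z (hS0 z hz))).1 (hmin hz)
  obtain ⟨κ, hκ, hκS⟩ := key
  refine ⟨κ, hκ, fun z hz => ?_⟩
  suffices κ * V z ≤ D z by simp only [hD, hV] at this ⊢; linarith
  rcases eq_or_ne z 0 with rfl | hz0
  · simp [hD, hV]
  have hn : ‖z‖ ≠ 0 := norm_ne_zero_iff.2 hz0
  have hmem : ‖z‖⁻¹ • z ∈ S := by
    refine ⟨by simp [norm_smul, hn], ?_⟩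
    simp only [Set.mem_ofPred_eq, Pi.smul_apply, smul_eq_mul, mul_assoc]
    rw [← mul_sum, hz, mul_zero]
  have h1 := hκS _ hmem
  have hVs : ∀ c : ℝ, V (c • z) = c ^ 2 * V z := fun c => by
    simp only [hV, Pi.smul_apply, smul_eq_mul, mul_sum]
    exact sum_congr rfl fun j _ => by ring
  have hDs : ∀ c : ℝ, D (c • z) = c ^ 2 * D z := fun c => by
    have h2 : ∀ j, ∑ i, (c • z) i * A i j = c * ∑ i, z i * A i j := fun j => by
      rw [mul_sum]; exact sum_congr rfl fun i _ => by simp [mul_assoc]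
    simp only [hD, hVs, h2]
    rw [mul_sub, mul_left_comm]
    congr 1
    rw [mul_sum]
    exact sum_congr rfl fun j _ => by simp only [Pi.smul_apply, smul_eq_mul]; ring
  rw [hVs, hDs] at h1
  have hc : 0 < ‖z‖⁻¹ ^ 2 := by positivity
  nlinarith [(mul_le_mul_iff_right₀ hc).1 (by linarith : ‖z‖⁻¹ ^ 2 * (κ * V z) ≤ ‖z‖⁻¹ ^ 2 * D z)]

end PerronData

end Perron

/-! ### Dominant eigenvalue and uniqueness of the Perron vector -/

theorem PerronData.domEigenvalue_eq {K : ℕ} {A : Matrix (Fin K) (Fin K) ℝ} {r : ℝ}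
    {p v : Fin K → ℝ} (h : PerronData A r p v) : domEigenvalue A = r := by
  refine IsGreatest.csSup_eq ⟨⟨(r : ℂ), ?_, Complex.ofReal_re r⟩, ?_⟩
  · have hne : Nonempty (Fin K) := by
      by_contra hc
      rw [not_nonempty_iff] at hc
      simpa using h.p_sum
    rw [← Matrix.spectrum_toLin', ← Module.End.hasEigenvalue_iff_mem_spectrum]
    refine Module.End.hasEigenvalue_of_hasEigenvector (x := fun i => (v i : ℂ)) ⟨?_, ?_⟩
    · rw [Module.End.mem_eigenspace_iff]
      ext i
      simp only [Matrix.toLin'_apply, Matrix.mulVec, dotProduct, Matrix.map_apply, Pi.smul_apply,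
        smul_eq_mul]
      exact_mod_cast h.right i
    · intro h0
      have := congrFun h0 hne.some
      simp [(h.v_pos _).ne'] at this
  · rintro _ ⟨μ, hμ, rfl⟩
    rw [← Matrix.spectrum_toLin', ← Module.End.hasEigenvalue_iff_mem_spectrum] at hμ
    obtain ⟨z, hz, hz0⟩ := hμ.exists_hasEigenvector
    rw [Module.End.mem_eigenspace_iff] at hz
    have h1 : ∀ i, ‖μ‖ * ‖z i‖ ≤ ∑ j, A i j * ‖z j‖ := by
      intro i
      have := congrFun hz i
      simp only [Matrix.toLin'_apply, Matrix.mulVec, dotProduct, Matrix.map_apply, Pi.smul_apply,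
        smul_eq_mul] at this
      rw [← norm_mul, ← this]
      refine (norm_sum_le _ _).trans (Finset.sum_le_sum fun j _ => ?_)
      rw [norm_mul, Complex.norm_real, Real.norm_of_nonneg (h.irr.nonneg i j)]
    -- Pairing |μ||z| ≤ A|z| with the positive left eigenvector p turns the right-hand side into r
    -- times the same positive sum.
    have h2 : ‖μ‖ * ∑ i, p i * ‖z i‖ ≤ r * ∑ i, p i * ‖z i‖ := by
      calc ‖μ‖ * ∑ i, p i * ‖z i‖ = ∑ i, p i * (‖μ‖ * ‖z i‖) := by
            rw [Finset.mul_sum]; exact Finset.sum_congr rfl fun i _ => by ring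
        _ ≤ ∑ i, p i * ∑ j, A i j * ‖z j‖ :=
            Finset.sum_le_sum fun i _ => mul_le_mul_of_nonneg_left (h1 i) (h.p_pos i).le
        _ = ∑ j, (∑ i, p i * A i j) * ‖z j‖ := by
            simp only [Finset.mul_sum, Finset.sum_mul]
            rw [Finset.sum_comm]
            exact Finset.sum_congr rfl fun i _ => Finset.sum_congr rfl fun j _ => by ring
        _ = _ := by
            simp only [h.left, Finset.mul_sum]
            exact Finset.sum_congr rfl fun i _ => by ring
    obtain ⟨j, hj⟩ := Function.ne_iff.1 hz0
    have h3 : 0 < ∑ i, p i * ‖z i‖ :=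
      Finset.sum_pos' (fun i _ => mul_nonneg (h.p_pos i).le (norm_nonneg _))
        ⟨j, Finset.mem_univ _, mul_pos (h.p_pos j) (norm_pos_iff.2 hj)⟩
    exact (Complex.re_le_norm μ).trans (le_of_mul_le_mul_right h2 h3)

theorem PerronData.isPerronVector {K : ℕ} {A : Matrix (Fin K) (Fin K) ℝ} {r : ℝ}
    {p v : Fin K → ℝ} (h : PerronData A r p v) : IsPerronVector A p := by
  refine ⟨h.p_pos, h.p_sum, ?_⟩
  ext j
  rw [h.domEigenvalue_eq]
  exact h.left j

/-- A left eigenvector for r annihilates the Dirichlet form, hence is proportional to p; the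
normalization fixes the factor. -/
theorem PerronData.isPerronVector_unique {K : ℕ} {A : Matrix (Fin K) (Fin K) ℝ} {r : ℝ}
    {p v w : Fin K → ℝ} (h : PerronData A r p v) (hw : IsPerronVector A w) : w = p := by
  have hA : ∀ j, ∑ i, w i * A i j = r * w j := fun j => by
    have := congrFun hw.left_eigen j
    rwa [h.domEigenvalue_eq] at this
  have hrat := h.ratio_eq_of_dirichlet_eq_zero (z := w) (by
    simp only [hA, Finset.mul_sum, ← Finset.sum_sub_distrib]
    exact (Finset.sum_eq_zero fun j _ => by ring).le)
  ext i
  have h1 : ∑ j, w j = w i / p i := by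
    calc ∑ j, w j = w i / p i * ∑ j, p j := by
          rw [Finset.mul_sum]
          exact Finset.sum_congr rfl fun j _ => by
            rw [hrat i j, div_mul_cancel₀ _ (h.p_pos j).ne']
      _ = _ := by rw [h.p_sum, mul_one]
  rw [hw.sum_eq_one] at h1
  exact ((div_eq_one_iff_eq (h.p_pos i).ne').1 h1.symm)

theorem PerronData.perronVector_eq {K : ℕ} {A : Matrix (Fin K) (Fin K) ℝ} {r : ℝ}
    {p v : Fin K → ℝ} (h : PerronData A r p v) : perronVector A = p := by
  have hex : ∃ w, IsPerronVector A w := ⟨p, h.isPerronVector⟩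
  rw [perronVector, dif_pos hex]
  exact h.isPerronVector_unique hex.choose_spec

end Urn

namespace Urn

/-! ### Deterministic stochastic-approximation recursion -/

/-- The error δ needs no summability: above any level η/2 it is eventually absorbed by the
contraction κτ, and ∑ τ = ∞ drives the excess over that level to 0. -/
theorem tendsto_zero_of_recursion {ρ τ δ : ℕ → ℝ} {κ : ℝ} (hκ : 0 < κ) (hρ : ∀ n, 0 ≤ ρ n)
    (hτ : ∀ᶠ n in atTop, 0 ≤ τ n) (hτ0 : Tendsto τ atTop (𝓝 0)) (hτs : ¬ Summable τ)
    (hδ : Tendsto δ atTop (𝓝 0))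
    (hrec : ∀ᶠ n in atTop, ρ (n + 1) ≤ (1 - κ * τ n) * ρ n + τ n * δ n) :
    Tendsto ρ atTop (𝓝 0) := by
  rw [Metric.tendsto_atTop]
  intro η hη
  have h1 : ∀ᶠ n in atTop, κ * τ n < 1 := by
    have := hτ0.const_mul κ
    rw [mul_zero] at this
    exact this.eventually_lt_const one_pos
  have h2 : ∀ᶠ n in atTop, δ n < κ * (η / 2) := hδ.eventually_lt_const (by positivity)
  obtain ⟨N, hN⟩ := eventually_atTop.1 (h1.and (h2.and (hτ.and hrec)))
  -- Once δ < κη/2, the identity (1 - κτ)ρ + τκη/2 - η/2 = (1 - κτ)(ρ - η/2) makes the excess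
  -- contract without error.
  set y : ℕ → ℝ := fun n => max (ρ (N + n) - η / 2) 0 with hy
  have hy0 : ∀ n, 0 ≤ y n := fun n => le_max_right _ _
  have hstep : ∀ n, y (n + 1) ≤ (1 - κ * τ (N + n)) * y n := by
    intro n
    obtain ⟨a1, a2, a3, a4⟩ := hN (N + n) (Nat.le_add_right _ _)
    refine max_le ?_ (mul_nonneg (by linarith) (hy0 n))
    have a5 : ρ (N + n) - η / 2 ≤ y n := le_max_left _ _
    have a6 : τ (N + n) * δ (N + n) ≤ τ (N + n) * (κ * (η / 2)) :=
      mul_le_mul_of_nonneg_left a2.le a3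
    have a7 := mul_le_mul_of_nonneg_left a5 (by linarith : 0 ≤ 1 - κ * τ (N + n))
    have a8 : ρ (N + (n + 1)) = ρ (N + n + 1) := rfl
    rw [a8]
    linarith
  have hexp : ∀ n, y n ≤ Real.exp (-(κ * ∑ k ∈ Finset.range n, τ (N + k))) * y 0 := by
    intro n
    induction n with
    | zero => simp
    | succ n ih =>
      rw [Finset.sum_range_succ, mul_add, neg_add, Real.exp_add]
      have b1 : 1 - κ * τ (N + n) ≤ Real.exp (-(κ * τ (N + n))) := by
        have := Real.add_one_le_exp (-(κ * τ (N + n))); linarith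
      calc y (n + 1) ≤ (1 - κ * τ (N + n)) * y n := hstep n
        _ ≤ Real.exp (-(κ * τ (N + n))) * y n := mul_le_mul_of_nonneg_right b1 (hy0 n)
        _ ≤ Real.exp (-(κ * τ (N + n))) *
            (Real.exp (-(κ * ∑ k ∈ Finset.range n, τ (N + k))) * y 0) :=
          mul_le_mul_of_nonneg_left ih (Real.exp_pos _).le
        _ = _ := by ring
  have hsum : Tendsto (fun n => ∑ k ∈ Finset.range n, τ (N + k)) atTop atTop := by
    refine (not_summable_iff_tendsto_nat_atTop_of_nonneg fun k => ?_).1 ?_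
    · exact (hN (N + k) (Nat.le_add_right _ _)).2.2.1
    · simpa only [add_comm N] using fun h => hτs ((summable_nat_add_iff N).1 h)
  have hlim : Tendsto (fun n => Real.exp (-(κ * ∑ k ∈ Finset.range n, τ (N + k))) * y 0)
      atTop (𝓝 0) := by
    have := (Real.tendsto_exp_neg_atTop_nhds_zero.comp (hsum.const_mul_atTop hκ)).mul_const (y 0)
    simpa using this
  obtain ⟨M, hM⟩ := eventually_atTop.1 (hlim.eventually_lt_const (half_pos hη))
  refine ⟨N + M, fun n hn => ?_⟩
  obtain ⟨k, rfl⟩ := Nat.exists_eq_add_of_le (le_trans (Nat.le_add_right N M) hn)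
  have c1 := (hexp k).trans_lt (hM k (by omega))
  have c2 : ρ (N + k) - η / 2 ≤ y k := le_max_left _ _
  rw [Real.dist_0_eq_abs, abs_of_nonneg (hρ _)]
  linarith

section

variable {ι : Type*} [Fintype ι]

/-- The Lyapunov function V(z) = ∑ (v_j/p_j) z_j² reduces the vector recursion to the scalar one,
with rate 2κ from the spectral gap on z·v = 0. -/
theorem PerronData.tendsto_zero_of_recursion {A : Matrix ι ι ℝ} {r : ℝ} {p v : ι → ℝ}
    (h : PerronData A r p v) {z ζ : ℕ → ι → ℝ} {τ : ℕ → ℝ} {B : ℝ}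
    (hτ : ∀ᶠ n in atTop, 0 ≤ τ n) (hτ0 : Tendsto τ atTop (𝓝 0)) (hτs : ¬ Summable τ)
    (hz : ∀ᶠ n in atTop, ∀ i, |z n i| ≤ B) (hζ : ∀ i, Tendsto (fun n => ζ n i) atTop (𝓝 0))
    (hv : ∀ᶠ n in atTop, ∑ i, z n i * v i = 0)
    (hrec : ∀ᶠ n in atTop, ∀ i,
      z (n + 1) i = z n i + τ n * (∑ j, z n j * A j i - r * z n i + ζ n i)) (i : ι) :
    Tendsto (fun n => z n i) atTop (𝓝 0) := by
  obtain ⟨κ, hκ, hgap⟩ := h.exists_gap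
  have hw : ∀ j, 0 < v j / p j := fun j => div_pos (h.v_pos j) (h.p_pos j)
  set V : (ι → ℝ) → ℝ := fun z => ∑ j, v j / p j * z j ^ 2 with hV
  have hVnn : ∀ z, 0 ≤ V z := fun z =>
    Finset.sum_nonneg fun j _ => mul_nonneg (hw j).le (sq_nonneg _)
  set g : ℕ → ι → ℝ := fun n i => ∑ j, z n j * A j i - r * z n i + ζ n i with hg
  have hzO : ∀ j, (fun n => z n j) =O[atTop] (fun _ => (1 : ℝ)) := fun j =>
    Asymptotics.IsBigO.of_bound B (hz.mono fun n hn => by simpa using hn j)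
  have hgO : ∀ j, (fun n => g n j) =O[atTop] (fun _ => (1 : ℝ)) := fun j => by
    refine ((Asymptotics.IsBigO.fun_sum fun i _ => ?_).sub ((hzO j).const_mul_left r)).add
      ((hζ j).isBigO_one ℝ)
    simpa only [mul_comm] using (hzO i).const_mul_left (A i j)
  -- Error in V(z + τg): the cross term with ζ, and the second-order term τ²V(g) with one factor τ
  -- taken out. Both tend to 0 because z and g are bounded.
  set δ : ℕ → ℝ := fun n => 2 * ∑ j, v j / p j * (z n j * ζ n j) + τ n * V (g n) with hδdef
  have hδ : Tendsto δ atTop (𝓝 0) := by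
    have e1 : ∀ j, Tendsto (fun n => z n j * ζ n j) atTop (𝓝 0) := fun j => by
      have := (hzO j).mul_isLittleO ((Asymptotics.isLittleO_one_iff ℝ).2 (hζ j))
      simpa using (Asymptotics.isLittleO_one_iff ℝ).1 (by simpa using this)
    have e2 : (fun n => V (g n)) =O[atTop] (fun _ => (1 : ℝ)) := by
      refine Asymptotics.IsBigO.fun_sum fun j _ => Asymptotics.IsBigO.const_mul_left ?_ _
      simpa using (hgO j).pow 2
    have e3 : Tendsto (fun n => τ n * V (g n)) atTop (𝓝 0) := by
      have := ((Asymptotics.isLittleO_one_iff ℝ).2 hτ0).mul_isBigO e2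
      simpa using (Asymptotics.isLittleO_one_iff ℝ).1 (by simpa using this)
    have e4 := (tendsto_finsetSum Finset.univ fun j _ => (e1 j).const_mul (v j / p j)).const_mul 2
    simpa [hδdef] using e4.add e3
  have hVlim : Tendsto (fun n => V (z n)) atTop (𝓝 0) := by
    refine Urn.tendsto_zero_of_recursion (κ := 2 * κ) (by linarith) (fun n => hVnn _) hτ hτ0 hτs hδ ?_
    filter_upwards [hτ, hv, hrec] with n h1 h2 h3
    have h4 := hgap _ h2
    have h5 : V (z (n + 1)) = V (z n) + 2 * τ n * (∑ j, v j / p j * z n j * ∑ i, z n i * A i j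
        - r * V (z n)) + τ n * δ n := by
      simp only [hV, hδdef]
      have : ∀ j, z (n + 1) j = z n j + τ n * g n j := h3
      simp only [this]
      have e1 : ∑ j, v j / p j * (z n j + τ n * g n j) ^ 2 = ∑ j, v j / p j * z n j ^ 2 +
          2 * τ n * ∑ j, v j / p j * z n j * g n j + τ n ^ 2 * ∑ j, v j / p j * g n j ^ 2 := by
        simp only [Finset.mul_sum, ← Finset.sum_add_distrib]
        exact Finset.sum_congr rfl fun j _ => by ring
      have e2 : ∑ j, v j / p j * z n j * g n j = ∑ j, v j / p j * z n j * ∑ i, z n i * A i j -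
          r * ∑ j, v j / p j * z n j ^ 2 + ∑ j, v j / p j * (z n j * ζ n j) := by
        rw [Finset.mul_sum, ← Finset.sum_sub_distrib, ← Finset.sum_add_distrib]
        exact Finset.sum_congr rfl fun j _ => by simp only [hg]; ring
      rw [e1, e2]
      ring
    have h6 := mul_le_mul_of_nonneg_left h4 (by linarith : 0 ≤ 2 * τ n)
    rw [h5]
    simp only [hV] at h6 ⊢
    nlinarith [h6]
  have hsq : Tendsto (fun n => z n i ^ 2) atTop (𝓝 0) := by
    have := hVlim.const_mul (v i / p i)⁻¹
    rw [mul_zero] at this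
    refine squeeze_zero (fun n => sq_nonneg _) (fun n => ?_) this
    rw [inv_mul_eq_div, le_div_iff₀' (hw i)]
    exact Finset.single_le_sum (f := fun j => v j / p j * z n j ^ 2)
      (fun j _ => mul_nonneg (hw j).le (sq_nonneg _)) (Finset.mem_univ i)
  have := hsq.sqrt
  simp only [Real.sqrt_sq_eq_abs, Real.sqrt_zero] at this
  exact (tendsto_zero_iff_abs_tendsto_zero _).2 this

end

end Urn

namespace Urn

/-! ### Pathwise convergence of the urn proportions -/

section

variable {ι : Type*} [Fintype ι]

/-- Deterministic urn dynamics: if the composition per step follows the averaged proportions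
pushed through `A`, then the proportions converge to the left Perron vector. -/
theorem PerronData.tendsto_proportions {A : Matrix ι ι ℝ} {r : ℝ} {p v : ι → ℝ}
    (h : PerronData A r p v) {x c : ℕ → ι → ℝ} (hx0 : ∀ n i, 0 ≤ x n i)
    (hx1 : ∀ n, ∑ i, x n i = 1) (hs : ∀ n, 0 < ∑ i, c n i)
    (hxc : ∀ n i, x n i = c n i / ∑ j, c n j)
    (hlim : ∀ i, Tendsto (fun n : ℕ => c n i / n -
      (∑ k ∈ Finset.range n, ∑ j, x k j * A j i) / n) atTop (𝓝 0)) :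
    (∀ i, Tendsto (fun n : ℕ => c n i / n) atTop (𝓝 (r * p i))) ∧
    (∀ i, Tendsto (fun n => x n i) atTop (𝓝 (p i))) ∧
    ∀ i, Tendsto (fun n : ℕ => (∑ k ∈ Finset.range n, x k i) / n) atTop (𝓝 (p i)) := by
  have hne : Nonempty ι := by
    by_contra hc
    rw [not_nonempty_iff] at hc
    simpa using h.p_sum
  have hp1 : ∀ i, p i ≤ 1 := fun i => by
    rw [← h.p_sum]
    exact Finset.single_le_sum (fun j _ => (h.p_pos j).le) (Finset.mem_univ i)
  obtain ⟨ia, hia⟩ := Finite.exists_min v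
  obtain ⟨ib, hib⟩ := Finite.exists_max v
  set a := v ia with ha_def
  set B := v ib with hB_def
  have ha : 0 < a := h.v_pos ia
  have hB : 0 < B := h.v_pos ib
  have hr := h.r_pos
  set b : ℕ → ι → ℝ := fun n i => ∑ k ∈ Finset.range n, x k i with hb
  set ε : ℕ → ι → ℝ := fun n i => c n i / n -
      (∑ k ∈ Finset.range n, ∑ j, x k j * A j i) / n with hε
  set s : ℕ → ℝ := fun n => ∑ i, c n i with hs_def
  set m : ℕ → ℝ := fun n => ∑ i, b n i * v i with hm
  set θ : ℕ → ℝ := fun n => ∑ i, ε n i * v i with hθ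
  have hb0 : ∀ n i, 0 ≤ b n i := fun n i => Finset.sum_nonneg fun k _ => hx0 k i
  have hbs : ∀ n, ∑ i, b n i = n := fun n => by
    simp only [hb]
    rw [Finset.sum_comm]
    simp [hx1]
  have hbn : ∀ n i, b n i ≤ n := fun n i => by
    rw [← hbs n]
    exact Finset.single_le_sum (fun j _ => hb0 n j) (Finset.mem_univ i)
  have hma : ∀ n, a * n ≤ m n := fun n => by
    rw [← hbs n, Finset.mul_sum]
    exact Finset.sum_le_sum fun i _ => by
      rw [mul_comm]; exact mul_le_mul_of_nonneg_left (hia i) (hb0 n i)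
  have hmB : ∀ n, m n ≤ B * n := fun n => by
    rw [← hbs n, Finset.mul_sum]
    exact Finset.sum_le_sum fun i _ => by
      rw [mul_comm B]; exact mul_le_mul_of_nonneg_left (hib i) (hb0 n i)
  have hc0 : ∀ n i, 0 ≤ c n i := fun n i => by
    have e1 : c n i = x n i * ∑ j, c n j := by rw [hxc, div_mul_cancel₀ _ (hs n).ne']
    rw [e1]
    exact mul_nonneg (hx0 n i) (hs n).le
  have hcb : ∀ n : ℕ, 0 < n → ∀ i, c n i = ∑ j, b n j * A j i + n * ε n i := by
    intro n hn i
    have hn' : (n : ℝ) ≠ 0 := by positivity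
    have e1 : ∑ k ∈ Finset.range n, ∑ j, x k j * A j i = ∑ j, b n j * A j i := by
      rw [Finset.sum_comm]
      exact Finset.sum_congr rfl fun j _ => by rw [← Finset.sum_mul]
    simp only [hε]
    rw [e1]
    field_simp
    ring
  -- Since Av = rv, pairing c_n = b_n A + nε_n with v leaves a scalar relation.
  have hcv : ∀ n : ℕ, 0 < n → ∑ i, c n i * v i = r * m n + n * θ n := by
    intro n hn
    simp only [hcb n hn, add_mul, Finset.sum_add_distrib, hm, hθ, Finset.mul_sum]
    congr 1
    · simp only [Finset.sum_mul]
      rw [Finset.sum_comm]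
      refine Finset.sum_congr rfl fun j _ => ?_
      rw [mul_left_comm, ← h.right j, Finset.mul_sum]
      exact Finset.sum_congr rfl fun i _ => by ring
    · exact Finset.sum_congr rfl fun i _ => by ring
  have hcvB : ∀ n, ∑ i, c n i * v i ≤ B * s n := fun n => by
    rw [hs_def, Finset.mul_sum]
    exact Finset.sum_le_sum fun i _ => by
      rw [mul_comm B]; exact mul_le_mul_of_nonneg_left (hib i) (hc0 n i)
  have hcva : ∀ n, a * s n ≤ ∑ i, c n i * v i := fun n => by
    rw [hs_def, Finset.mul_sum]
    exact Finset.sum_le_sum fun i _ => by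
      rw [mul_comm]; exact mul_le_mul_of_nonneg_left (hia i) (hc0 n i)
  have hθ0 : Tendsto θ atTop (𝓝 0) := by
    have := tendsto_finsetSum Finset.univ fun i _ => (hlim i).mul_const (v i)
    simpa [hθ] using this
  have hn0 : ∀ᶠ n : ℕ in atTop, 0 < n := eventually_gt_atTop 0
  -- B s_n ≥ c_n·v = r m_n + nθ_n ≥ (ra - ra/2)n as soon as θ_n > -ra/2. With the matching upper
  -- bound below, s_n has exact order n.
  have hsl : ∀ᶠ n : ℕ in atTop, r * a / (2 * B) * n ≤ s n := by
    filter_upwards [hn0, hθ0.eventually_const_lt (show -(r * a / 2) < 0 by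
      have := mul_pos hr ha; linarith)] with n hn hθn
    have hn' : (0 : ℝ) < n := by exact_mod_cast hn
    have e1 := hcvB n
    rw [hcv n hn] at e1
    have e2 := mul_le_mul_of_nonneg_left (hma n) hr.le
    have e3 := mul_le_mul_of_nonneg_left hθn.le hn'.le
    rw [div_mul_eq_mul_div, div_le_iff₀ (by positivity)]
    linarith
  have hsu : ∀ᶠ n : ℕ in atTop, s n ≤ (r * B + 1) / a * n := by
    filter_upwards [hn0, hθ0.eventually_lt_const one_pos] with n hn hθn
    have hn' : (0 : ℝ) < n := by exact_mod_cast hn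
    have e1 := hcva n
    rw [hcv n hn] at e1
    have e2 := mul_le_mul_of_nonneg_left (hmB n) hr.le
    have e3 := mul_le_mul_of_nonneg_left hθn.le hn'.le
    rw [div_mul_eq_mul_div, le_div_iff₀ ha]
    linarith
  have hnm : ∀ n : ℕ, 0 < n → 0 < m n ∧ n / m n ≤ a⁻¹ := by
    intro n hn
    have hn' : (0 : ℝ) < n := by exact_mod_cast hn
    have hmp : 0 < m n := (mul_pos ha hn').trans_le (hma n)
    refine ⟨hmp, ?_⟩
    rw [div_le_iff₀ hmp, inv_mul_eq_div, le_div_iff₀ ha, mul_comm]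
    exact hma n
  have hnmO : (fun n : ℕ => (n : ℝ) / m n) =O[atTop] (fun _ => (1 : ℝ)) :=
    Asymptotics.IsBigO.of_bound a⁻¹ <| hn0.mono fun n hn => by
      obtain ⟨h1, h2⟩ := hnm n hn
      rw [Real.norm_of_nonneg (by positivity), norm_one, mul_one]
      exact h2
  have hmulO : ∀ {f g : ℕ → ℝ}, f =O[atTop] (fun _ => (1 : ℝ)) → Tendsto g atTop (𝓝 0) →
      Tendsto (fun n => f n * g n) atTop (𝓝 0) := fun hf hg => by
    have := hf.mul_isLittleO ((Asymptotics.isLittleO_one_iff ℝ).2 hg)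
    simpa using (Asymptotics.isLittleO_one_iff ℝ).1 (by simpa using this)
  set e : ℕ → ℝ := fun n => n / m n * θ n with he
  have he0 : Tendsto e atTop (𝓝 0) := hmulO hnmO hθ0
  -- Dividing by m_n = b_n·v rather than by n, together with p·v = 1, places z_n exactly in the
  -- hyperplane z·v = 0. At n = 0 one has m_0 = 0, so the relations are only claimed for large n.
  set z : ℕ → ι → ℝ := fun n i => b n i / m n - p i with hz
  have hzB : ∀ᶠ n in atTop, ∀ i, |z n i| ≤ a⁻¹ + 1 := by
    filter_upwards [hn0] with n hn i
    obtain ⟨h1, h2⟩ := hnm n hn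
    have e1 : 0 ≤ b n i / m n := div_nonneg (hb0 n i) h1.le
    have e2 : b n i / m n ≤ a⁻¹ := (div_le_div_of_nonneg_right (hbn n i) h1.le).trans h2
    have e3 := (h.p_pos i).le
    have e4 := hp1 i
    have e5 : 0 < a⁻¹ := inv_pos.2 ha
    rw [abs_le]
    constructor <;> simp only [hz] <;> linarith
  have hzO : ∀ i, (fun n => z n i) =O[atTop] (fun _ => (1 : ℝ)) := fun i =>
    Asymptotics.IsBigO.of_bound (a⁻¹ + 1) (hzB.mono fun n hn => by simpa using hn i)
  have hzv : ∀ᶠ n in atTop, ∑ i, z n i * v i = 0 := by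
    filter_upwards [hn0] with n hn
    have h1 := (hnm n hn).1.ne'
    simp only [hz, sub_mul, Finset.sum_sub_distrib, h.pv_sum, div_mul_eq_mul_div,
      ← Finset.sum_div]
    rw [show ∑ i, b n i * v i = m n from rfl, div_self h1, sub_self]
  -- D_n is the growth factor m_{n+1}/m_n, because c_n·v = m_n(r + e_n). Renormalizing by it yields
  -- the step size τ_n = 1/(s_n D_n).
  set D : ℕ → ℝ := fun n => 1 + (s n)⁻¹ * (r + e n) with hD
  have hsinf : Tendsto s atTop atTop := by
    refine tendsto_atTop_mono' _ hsl ?_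
    exact tendsto_natCast_atTop_atTop.const_mul_atTop (by positivity)
  have hD1 : Tendsto D atTop (𝓝 1) := by
    have := (hsinf.inv_tendsto_atTop.mul (he0.const_add r)).const_add 1
    simpa [hD] using this
  have hDl : ∀ᶠ n in atTop, 1 / 2 < D n := hD1.eventually_const_lt (by norm_num)
  have hDu : ∀ᶠ n in atTop, D n < 2 := hD1.eventually_lt_const (by norm_num)
  set τ : ℕ → ℝ := fun n => (s n)⁻¹ / D n with hτ
  set ζ : ℕ → ι → ℝ := fun n i => n / m n * ε n i - e n * p i - z n i * e n with hζ
  have hζ0 : ∀ i, Tendsto (fun n => ζ n i) atTop (𝓝 0) := fun i => by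
    have := ((hmulO hnmO (hlim i)).sub (he0.mul_const (p i))).sub (hmulO (hzO i) he0)
    simpa [hζ] using this
  have hτ0 : ∀ᶠ n in atTop, 0 ≤ τ n := hDl.mono fun n hn =>
    div_nonneg (inv_nonneg.2 (hs n).le) (by linarith)
  have hτlim : Tendsto τ atTop (𝓝 0) := by
    have := hsinf.inv_tendsto_atTop.div hD1 one_ne_zero
    rwa [zero_div] at this
  -- From s_n ≤ (rB + 1)n/a and D_n < 2, τ_n is eventually at least a constant times 1/n.
  have hτs : ¬ Summable τ := by
    intro hsum
    have hk : 0 < 2 * ((r * B + 1) / a) := by positivity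
    refine Real.not_summable_natCast_inv
      ((summable_mul_left_iff (inv_pos.2 hk).ne').1
        (hsum.of_norm_bounded_eventually_nat ?_) : Summable fun n : ℕ => (n : ℝ)⁻¹)
    filter_upwards [hn0, hsu, hDl, hDu] with n hn h1 h2 h3
    rw [Real.norm_of_nonneg (by positivity), hτ, ← mul_inv]
    simp only [div_eq_mul_inv ((s n)⁻¹), ← mul_inv]
    refine inv_anti₀ (mul_pos (hs n) (by linarith)) ?_
    have h4 := mul_le_mul h1 h3.le (by linarith) ((hs n).le.trans h1)
    linarith
  have hrec : ∀ᶠ n in atTop, ∀ i,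
      z (n + 1) i = z n i + τ n * (∑ j, z n j * A j i - r * z n i + ζ n i) := by
    filter_upwards [hn0, hDl] with n hn hDn i
    have hm0 := (hnm n hn).1.ne'
    have hm1 := (hnm (n + 1) n.succ_pos).1.ne'
    have hs0 : s n ≠ 0 := (hs n).ne'
    have hD0 : D n ≠ 0 := by linarith
    have e1 : ∀ i, b (n + 1) i = b n i + c n i * (s n)⁻¹ := fun i => by
      simp only [hb]
      rw [Finset.sum_range_succ, hxc n i, div_eq_mul_inv]
    have e2 : m (n + 1) = m n * D n := by
      have : m (n + 1) = m n + (s n)⁻¹ * ∑ i, c n i * v i := by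
        simp only [hm, e1, Finset.mul_sum, ← Finset.sum_add_distrib]
        exact Finset.sum_congr rfl fun i _ => by ring
      rw [this, hcv n hn]
      simp only [hD, he]
      field_simp
    have e3 : ∑ j, b n j * A j i = m n * (∑ j, z n j * A j i + r * p i) := by
      rw [← h.left i, ← Finset.sum_add_distrib, Finset.mul_sum]
      refine Finset.sum_congr rfl fun j _ => ?_
      simp only [hz]
      field_simp
      ring
    have e4 : z (n + 1) i = (b n i + c n i * (s n)⁻¹) / (m n * D n) - p i := by
      rw [← e1, ← e2]
    have e5 : b n i = m n * (z n i + p i) := by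
      simp only [hz]; field_simp; ring
    have e6 : D n * s n = s n + (r + e n) := by
      simp only [hD]; field_simp
    rw [e4, hcb n hn i, e3, e5]
    have e7 : τ n = (s n * D n)⁻¹ := by
      simp only [hτ, mul_inv, div_eq_mul_inv]
    rw [e7]
    simp only [hζ]
    generalize ∑ j, z n j * A j i = q at *
    have hsD : s n * D n ≠ 0 := mul_ne_zero hs0 hD0
    field_simp
    linear_combination (-(m n) * (p i + z n i)) * e6
  have hz0 := h.tendsto_zero_of_recursion hτ0 hτlim hτs hzB hζ0 hzv hrec
  have hbm : ∀ i, Tendsto (fun n => b n i / m n) atTop (𝓝 (p i)) := fun i => by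
    simpa [hz] using (hz0 i).add_const (p i)
  -- The coordinates of b_n sum to n and those of p to 1, so summing b_n/m_n → p over the
  -- coordinates gives n/m_n → 1.
  have hnm1 : Tendsto (fun n : ℕ => (n : ℝ) / m n) atTop (𝓝 1) := by
    have := tendsto_finsetSum Finset.univ fun i _ => hbm i
    rw [h.p_sum] at this
    refine this.congr fun n => ?_
    rw [← Finset.sum_div, hbs]
  have havg : ∀ i, Tendsto (fun n : ℕ => b n i / n) atTop (𝓝 (p i)) := fun i => by
    have := (hbm i).div hnm1 one_ne_zero
    rw [div_one] at this
    refine this.congr' ?_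
    filter_upwards [hn0] with n hn
    have := (hnm n hn).1.ne'
    have hn' : (n : ℝ) ≠ 0 := by positivity
    simp only [Pi.div_apply]
    field_simp
  have hcn : ∀ i, Tendsto (fun n : ℕ => c n i / n) atTop (𝓝 (r * p i)) := fun i => by
    have hε0 : Tendsto (fun n => ε n i) atTop (𝓝 0) := hlim i
    have := (tendsto_finsetSum Finset.univ fun j _ => (havg j).mul_const (A j i)).add hε0
    rw [h.left, add_zero] at this
    refine this.congr' ?_
    filter_upwards [hn0] with n hn
    have hn' : (n : ℝ) ≠ 0 := by positivity
    rw [hcb n hn i, add_div, mul_div_cancel_left₀ _ hn', Finset.sum_div]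
    congr 1
    exact Finset.sum_congr rfl fun j _ => by ring
  have hsn : Tendsto (fun n : ℕ => s n / n) atTop (𝓝 r) := by
    have := tendsto_finsetSum Finset.univ fun i _ => hcn i
    rw [← Finset.mul_sum, h.p_sum, mul_one] at this
    refine this.congr fun n => ?_
    rw [← Finset.sum_div]
  refine ⟨hcn, fun i => ?_, havg⟩
  have := (hcn i).div hsn hr.ne'
  rw [mul_div_cancel_left₀ _ hr.ne'] at this
  refine this.congr' ?_
  filter_upwards [hn0] with n hn
  have hn' : (n : ℝ) ≠ 0 := by positivity
  rw [hxc, Pi.div_apply, div_div_div_cancel_right₀ hn']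

end

end Urn

namespace Urn

/-! ### Domination of tails -/

section Tail

open scoped ENNReal

/-- The superlevel set is open and upward closed, and continuity at 0 keeps it a positive distance
above 0. Tail bounds available only at positive levels thus apply to it. -/
theorem exists_setOf_lt_eq_Ioi {φ : ℝ → ℝ} (hφ : Continuous φ) (hmono : Monotone φ)
    (hφ0 : φ 0 = 0) {t : ℝ} (ht : 0 < t) (hne : {x | t < φ x}.Nonempty) :
    ∃ s, 0 < s ∧ {x | t < φ x} = Set.Ioi s := by
  set S := {x | t < φ x} with hS
  have hmem : {x | φ x < t} ∈ 𝓝 (0 : ℝ) :=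
    (isOpen_lt hφ continuous_const).mem_nhds (by simpa [hφ0] using ht)
  obtain ⟨u, hu, hu'⟩ := exists_Ico_subset_of_mem_nhds hmem ⟨1, one_pos⟩
  have hlow : ∀ x ∈ S, u ≤ x := by
    intro x hx
    by_contra hcon
    rcases le_or_gt 0 x with h0 | h0
    · exact lt_asymm (show φ x < t from hu' ⟨h0, not_le.1 hcon⟩) (show t < φ x from hx)
    · have := hmono h0.le
      rw [hφ0] at this
      exact absurd (ht.trans hx) (not_lt.2 this)
  have hbdd : BddBelow S := ⟨u, hlow⟩
  refine ⟨sInf S, hu.trans_le (le_csInf hne hlow), ?_⟩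
  ext x
  constructor
  · intro hx
    have hopen : S ∈ 𝓝 x := (isOpen_lt continuous_const hφ).mem_nhds hx
    obtain ⟨l, hl, hl'⟩ := exists_Ioc_subset_of_mem_nhds hopen ⟨x - 1, by linarith⟩
    have hm : (l + x) / 2 ∈ S := hl' ⟨by linarith, by linarith⟩
    exact (csInf_le hbdd hm).trans_lt (by linarith)
  · intro hx
    obtain ⟨y, hy, hyx⟩ := exists_lt_of_csInf_lt hne hx
    exact lt_of_lt_of_le hy (hmono hyx.le)

variable {Ω Ω' : Type*} [MeasurableSpace Ω] [MeasurableSpace Ω']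

/-- The tail of `Z` is at most `c` times the tail of `M`. -/
def TailLE (μ : Measure Ω) (ν : Measure Ω') (c : ℝ≥0∞) (Z : Ω → ℝ) (M : Ω' → ℝ) : Prop :=
  ∀ x : ℝ, 0 < x → μ {ω | x < Z ω} ≤ c * ν {ω | x < M ω}

variable {μ : Measure Ω} {ν : Measure Ω'} {c : ℝ≥0∞} {Z : Ω → ℝ} {M : Ω' → ℝ}

/-- Layer-cake formula: each superlevel set of φ(Z) is a tail event of Z, to which the hypothesis
applies. Discontinuous truncations are therefore replaced later by continuous monotone majorants. -/
theorem TailLE.lintegral_le (h : TailLE μ ν c Z M) (hZ : AEMeasurable Z μ) (hM : AEMeasurable M ν)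
    {φ : ℝ → ℝ} (hφ : Continuous φ) (hmono : Monotone φ) (hφ0 : φ 0 = 0) (hnn : ∀ x, 0 ≤ φ x) :
    ∫⁻ ω, ENNReal.ofReal (φ (Z ω)) ∂μ ≤ c * ∫⁻ ω, ENNReal.ofReal (φ (M ω)) ∂ν := by
  rw [lintegral_eq_lintegral_meas_lt μ (ae_of_all _ fun _ => hnn _) (hφ.measurable.comp_aemeasurable hZ),
    lintegral_eq_lintegral_meas_lt ν (ae_of_all _ fun _ => hnn _) (hφ.measurable.comp_aemeasurable hM),
    ← lintegral_const_mul]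
  · refine setLIntegral_mono' measurableSet_Ioi fun t ht => ?_
    rcases Set.eq_empty_or_nonempty {x | t < φ x} with he | hne
    · have : {ω | t < φ (Z ω)} = ∅ := by
        ext ω
        simpa using (Set.eq_empty_iff_forall_notMem.1 he) (Z ω)
      rw [this, measure_empty]
      exact zero_le
    · obtain ⟨s, hs, hs'⟩ := exists_setOf_lt_eq_Ioi hφ hmono hφ0 ht hne
      have e : ∀ x, t < φ x ↔ s < x := fun x => Set.ext_iff.1 hs' x
      simp only [e]
      exact h s hs
  · exact Antitone.measurable fun a b hab => measure_mono fun ω hω => lt_of_le_of_lt hab hω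

theorem TailLE.integrable (h : TailLE μ ν c Z M) (hc : c ≠ ∞) (hZ : AEMeasurable Z μ)
    (hZ0 : ∀ ω, 0 ≤ Z ω) (hM : Integrable M ν) : Integrable Z μ := by
  refine ⟨hZ.aestronglyMeasurable, ?_⟩
  rw [hasFiniteIntegral_iff_ofReal (ae_of_all _ hZ0)]
  have h1 := h.lintegral_le hZ hM.aemeasurable (φ := fun x => max x 0) (by fun_prop)
    (fun a b hab => max_le_max_right _ hab) (by simp) (fun x => le_max_right _ _)
  simp only [max_eq_left (hZ0 _)] at h1
  refine h1.trans_lt (ENNReal.mul_lt_top hc.lt_top ?_)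
  exact Integrable.lintegral_lt_top hM.pos_part

/-- The terms with k < ⌊y⌋ are at most 1 and contribute at most y; the others are at most y²/(k +
1)², with sum at most 2y²/(⌊y⌋ + 1) ≤ 2y. -/
theorem sum_min_sq_le {y : ℝ} (hy : 0 ≤ y) (n : ℕ) :
    ∑ k ∈ Finset.range n, (max (min y (k + 1)) 0) ^ 2 / ((k : ℝ) + 1) ^ 2 ≤ 3 * y := by
  set N := ⌊y⌋₊ with hN
  have h1 : ∀ k : ℕ, (max (min y (k + 1)) 0) ^ 2 / ((k : ℝ) + 1) ^ 2 ≤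
      (if k < N then 1 else 0) + if N ≤ k then y ^ 2 * (((k + 1 : ℕ) : ℝ) ^ 2)⁻¹ else 0 := by
    intro k
    have hk : (0 : ℝ) < k + 1 := by positivity
    have hm : 0 ≤ min y ((k : ℝ) + 1) := le_min hy hk.le
    rw [max_eq_left hm]
    split_ifs with a1 a2 a2
    · omega
    · rw [add_zero, div_le_one (by positivity)]
      exact pow_le_pow_left₀ hm (min_le_right _ _) 2
    · rw [zero_add, div_eq_mul_inv]
      push_cast
      exact mul_le_mul_of_nonneg_right (pow_le_pow_left₀ hm (min_le_left _ _) 2) (by positivity)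
    · omega
  refine (Finset.sum_le_sum fun k _ => h1 k).trans ?_
  rw [Finset.sum_add_distrib]
  have h2 : ∑ k ∈ Finset.range n, (if k < N then (1 : ℝ) else 0) ≤ y := by
    rw [← Finset.sum_filter, Finset.sum_const, nsmul_eq_mul, mul_one]
    have : ((Finset.range n).filter (· < N)).card ≤ N := by
      refine (Finset.card_le_card (t := Finset.range N) fun k hk => ?_).trans (by simp)
      simp at hk ⊢
      exact hk.2
    exact (Nat.cast_le.2 this).trans (Nat.floor_le hy)
  have h3 : ∑ k ∈ Finset.range n, (if N ≤ k then y ^ 2 * (((k + 1 : ℕ) : ℝ) ^ 2)⁻¹ else 0) ≤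
      2 * y := by
    rw [← Finset.sum_filter, ← Finset.mul_sum]
    have e1 : ∑ k ∈ (Finset.range n).filter (N ≤ ·), (((k + 1 : ℕ) : ℝ) ^ 2)⁻¹ ≤
        ∑ i ∈ Finset.Ioo N (n + 1), ((i : ℝ) ^ 2)⁻¹ := by
      rw [← Finset.sum_image (s := (Finset.range n).filter (N ≤ ·)) (g := fun k => k + 1)
        (f := fun i : ℕ => ((i : ℝ) ^ 2)⁻¹) (by intro a _ b _ h; simpa using h)]
      refine Finset.sum_le_sum_of_subset_of_nonneg (fun i hi => ?_) (fun i _ _ => by positivity)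
      simp only [Finset.mem_image, Finset.mem_filter, Finset.mem_range] at hi
      obtain ⟨k, hk, rfl⟩ := hi
      simp only [Finset.mem_Ioo]
      omega
    have e2 := e1.trans (sum_Ioo_inv_sq_le (α := ℝ) N (n + 1))
    have e3 : y < N + 1 := Nat.lt_floor_add_one y
    calc y ^ 2 * _ ≤ y ^ 2 * (2 / (N + 1)) := mul_le_mul_of_nonneg_left e2 (sq_nonneg _)
      _ ≤ 2 * y := by
        rw [mul_div_assoc', div_le_iff₀ (by positivity)]
        nlinarith
  linarith

/-- Only the indices k < ⌊2y⌋ contribute, each at most 2y/(k + 1). The harmonic sum produces the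
logarithm, through 1 + log(2y) ≤ 2 + log y. -/
theorem sum_posPart_le {y : ℝ} (hy : 0 ≤ y) (n : ℕ) :
    ∑ k ∈ Finset.range n, 2 / ((k : ℝ) + 1) * max (y - (k + 1) / 2) 0 ≤
      4 * y + 2 * (y * Real.posLog y) := by
  set N := ⌊2 * y⌋₊ with hN
  have hlog : 0 ≤ y * Real.posLog y := mul_nonneg hy Real.posLog_nonneg
  have h1 : ∀ k : ℕ, 2 / ((k : ℝ) + 1) * max (y - (k + 1) / 2) 0 ≤
      if k < N then 2 * y * ((k : ℝ) + 1)⁻¹ else 0 := by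
    intro k
    have hk : (0 : ℝ) < k + 1 := by positivity
    split_ifs with a1
    · rw [div_eq_mul_inv, mul_assoc, mul_assoc, mul_comm y]
      have : max (y - ((k : ℝ) + 1) / 2) 0 ≤ y := max_le (by linarith) hy
      gcongr
    · have : 2 * y < k + 1 := by
        refine (Nat.lt_floor_add_one _).trans_le ?_
        exact_mod_cast Nat.succ_le_succ (not_lt.1 a1)
      rw [max_eq_right (by linarith), mul_zero]
  refine (Finset.sum_le_sum fun k _ => h1 k).trans ?_
  rw [← Finset.sum_filter]
  have h2 : ∑ k ∈ (Finset.range n).filter (· < N), 2 * y * ((k : ℝ) + 1)⁻¹ ≤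
      2 * y * ((harmonic N : ℚ) : ℝ) := by
    rw [← Finset.mul_sum]
    refine mul_le_mul_of_nonneg_left ?_ (by linarith)
    rw [harmonic]
    push_cast
    refine Finset.sum_le_sum_of_subset_of_nonneg (fun i hi => ?_) (fun i _ _ => by positivity)
    simp at hi ⊢
    exact hi.2
  refine h2.trans ?_
  rcases lt_or_ge (2 * y) 1 with h3 | h3
  · have : N = 0 := Nat.floor_eq_zero.2 h3
    simp only [this, harmonic_zero, Rat.cast_zero, mul_zero]
    linarith
  · have h4 := harmonic_floor_le_one_add_log (2 * y) h3
    have hy' : 0 < y := by linarith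
    rw [Real.log_mul two_ne_zero hy'.ne'] at h4
    have h5 : Real.log y ≤ Real.posLog y := by
      rw [Real.posLog]; exact le_max_right _ _
    have h6 : Real.log 2 ≤ 1 := by
      have := Real.log_two_lt_d9; linarith
    have h7 : ((harmonic N : ℚ) : ℝ) ≤ 2 + Real.posLog y := by linarith
    have h8 := mul_le_mul_of_nonneg_left h7 (by linarith : 0 ≤ 2 * y)
    linarith

/-- All Z_k are compared with the same M, so the series can be summed pointwise in M before
integrating. -/
theorem tsum_lintegral_ne_top_of_tailLE {Z : ℕ → Ω → ℝ} (h : ∀ k, TailLE μ ν c (Z k) M)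
    (hc : c ≠ ∞) (hZ : ∀ k, AEMeasurable (Z k) μ) (hM : AEMeasurable M ν) {φ : ℕ → ℝ → ℝ}
    (hφ : ∀ k, Continuous (φ k)) (hmono : ∀ k, Monotone (φ k)) (hφ0 : ∀ k, φ k 0 = 0)
    (hnn : ∀ k x, 0 ≤ φ k x) {Φ : Ω' → ℝ} (hΦ : Integrable Φ ν)
    (hle : ∀ᵐ ω ∂ν, ∀ n, ∑ k ∈ Finset.range n, φ k (M ω) ≤ Φ ω) :
    ∑' k, ∫⁻ ω, ENNReal.ofReal (φ k (Z k ω)) ∂μ ≠ ∞ := by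
  refine ne_top_of_le_ne_top (b := c * ∫⁻ ω, ENNReal.ofReal (Φ ω) ∂ν)
    (ENNReal.mul_ne_top hc hΦ.lintegral_lt_top.ne) ?_
  calc _ ≤ ∑' k, c * ∫⁻ ω, ENNReal.ofReal (φ k (M ω)) ∂ν :=
        ENNReal.tsum_le_tsum fun k => (h k).lintegral_le (hZ k) hM (hφ k) (hmono k) (hφ0 k) (hnn k)
    _ = c * ∫⁻ ω, ∑' k, ENNReal.ofReal (φ k (M ω)) ∂ν := by
        rw [ENNReal.tsum_mul_left, lintegral_tsum]
        exact fun k => ((hφ k).measurable.comp_aemeasurable hM).ennreal_ofReal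
    _ ≤ _ := by
        gcongr c * ?_
        refine lintegral_mono_ae ?_
        filter_upwards [hle] with ω hω
        rw [ENNReal.tsum_eq_iSup_nat]
        refine iSup_le fun n => ?_
        rw [← ENNReal.ofReal_sum_of_nonneg fun k _ => hnn k _]
        exact ENNReal.ofReal_le_ofReal (hω n)

theorem tsum_lintegral_min_sq_ne_top {Z : ℕ → Ω → ℝ} (h : ∀ k, TailLE μ ν c (Z k) M)
    (hc : c ≠ ∞) (hZ : ∀ k, AEMeasurable (Z k) μ) (hM : Integrable M ν) (hM0 : ∀ᵐ ω ∂ν, 0 < M ω) :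
    ∑' k : ℕ, ∫⁻ ω, ENNReal.ofReal ((max (min (Z k ω) (k + 1)) 0) ^ 2 / ((k : ℝ) + 1) ^ 2) ∂μ ≠ ∞ := by
  refine tsum_lintegral_ne_top_of_tailLE h hc hZ hM.aemeasurable
    (φ := fun k x => (max (min x (k + 1)) 0) ^ 2 / ((k : ℝ) + 1) ^ 2)
    (fun k => by fun_prop) (fun k a b hab => ?_) (fun k => ?_) (fun k x => by positivity)
    (hM.const_mul 3) (hM0.mono fun ω hω n => sum_min_sq_le hω.le n)
  · have : max (min a ((k : ℝ) + 1)) 0 ≤ max (min b ((k : ℝ) + 1)) 0 :=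
      max_le_max_right _ (min_le_min_right _ hab)
    have h0 : 0 ≤ max (min a ((k : ℝ) + 1)) 0 := le_max_right _ _
    simp only
    gcongr
  · have hk : (0 : ℝ) ≤ k + 1 := by positivity
    simp [min_eq_left hk]

/-- The function 2·max(x - (k + 1)/2, 0) is a continuous monotone majorant of x·1{x > k + 1}, so
this controls the parts removed by truncation at k + 1, with weight 1/(k + 1). -/
theorem tsum_lintegral_posPart_ne_top {Z : ℕ → Ω → ℝ} (h : ∀ k, TailLE μ ν c (Z k) M)
    (hc : c ≠ ∞) (hZ : ∀ k, AEMeasurable (Z k) μ) (hM : Integrable M ν) (hM0 : ∀ᵐ ω ∂ν, 0 < M ω)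
    (hMlog : Integrable (fun ω => M ω * Real.posLog (M ω)) ν) :
    ∑' k : ℕ, ∫⁻ ω, ENNReal.ofReal (2 / ((k : ℝ) + 1) * max (Z k ω - (k + 1) / 2) 0) ∂μ ≠ ∞ := by
  refine tsum_lintegral_ne_top_of_tailLE h hc hZ hM.aemeasurable
    (φ := fun k x => 2 / ((k : ℝ) + 1) * max (x - (k + 1) / 2) 0)
    (fun k => by fun_prop) (fun k a b hab => ?_) (fun k => ?_) (fun k x => by positivity)
    ((hM.const_mul 4).add (hMlog.const_mul 2)) (hM0.mono fun ω hω n => sum_posPart_le hω.le n)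
  · simp only
    gcongr
  · have hk : (0 : ℝ) - (k + 1) / 2 ≤ 0 := by
      have : (0 : ℝ) ≤ k := by positivity
      linarith
    rw [max_eq_right hk, mul_zero]

theorem uniformIntegrable_of_tailLE [IsFiniteMeasure μ] {E : Type*} [NormedAddCommGroup E]
    {Z : ℕ → Ω → ℝ} (h : ∀ k, TailLE μ ν c (Z k) M)
    (hc : c ≠ ∞) (hZ : ∀ k, AEMeasurable (Z k) μ) (hM : Integrable M ν)
    {Y : ℕ → Ω → E} (hY : ∀ k, AEStronglyMeasurable (Y k) μ) (hYZ : ∀ k ω, ‖Y k ω‖ ≤ Z k ω) :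
    UniformIntegrable Y 1 μ := by
  refine uniformIntegrable_of le_rfl ENNReal.one_ne_top hY fun ε hε => ?_
  -- For x ≥ n, 2·max(x - n/2, 0) ≥ x, so this bounds the mass of every Z_k above n uniformly in k.
  -- The integrals vanish in the limit by domination by 2|M|.
  have hlim : Tendsto (fun n : ℕ => c * ∫⁻ ω, ENNReal.ofReal (2 * max (M ω - n / 2) 0) ∂ν) atTop
      (𝓝 (c * 0)) := by
    refine ENNReal.Tendsto.const_mul ?_ (Or.inr hc)
    rw [← lintegral_zero (μ := ν)]
    refine tendsto_lintegral_of_dominated_convergence' (fun ω => ENNReal.ofReal (2 * |M ω|))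
      (fun n => ?_) (fun n => ae_of_all _ fun ω => ?_) ?_ (ae_of_all _ fun ω => ?_)
    · exact (((hM.aemeasurable.sub_const _).max aemeasurable_const).const_mul 2).ennreal_ofReal
    · refine ENNReal.ofReal_le_ofReal ?_
      have : (0 : ℝ) ≤ n / 2 := by positivity
      have h1 : max (M ω - n / 2) 0 ≤ |M ω| :=
        max_le (by linarith [le_abs_self (M ω)]) (abs_nonneg _)
      linarith
    · exact (hM.abs.const_mul 2).lintegral_lt_top.ne
    · refine tendsto_const_nhds.congr' ?_
      obtain ⟨N, hN⟩ := exists_nat_gt (2 * M ω)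
      filter_upwards [eventually_ge_atTop N] with n hn
      have : (N : ℝ) ≤ n := by exact_mod_cast hn
      rw [max_eq_right (by linarith)]
      simp
  rw [mul_zero] at hlim
  obtain ⟨N, hN⟩ := ((tendsto_order.1 hlim).2 (ENNReal.ofReal ε) (by simpa using hε)).exists
  refine ⟨N, fun k => le_trans ?_ hN.le⟩
  refine le_trans ?_ ((h k).lintegral_le (hZ k) hM.aemeasurable
    (φ := fun x => 2 * max (x - N / 2) 0) (by fun_prop) (fun a b hab => ?_) ?_
    (fun x => by positivity))
  · rw [eLpNorm_one_eq_lintegral_enorm]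
    refine lintegral_mono fun ω => ?_
    by_cases hω : (N : NNReal) ≤ ‖Y k ω‖₊
    · rw [Set.indicator_of_mem (by exact hω), ← ofReal_norm]
      refine ENNReal.ofReal_le_ofReal ?_
      have h1 : (N : ℝ) ≤ ‖Y k ω‖ := by exact_mod_cast hω
      have h2 := hYZ k ω
      have h3 := le_max_left (Z k ω - N / 2) 0
      linarith
    · rw [Set.indicator_of_notMem (by exact hω)]
      simp
  · simp only
    gcongr
  · have : (0 : ℝ) - N / 2 ≤ 0 := by
      have : (0 : ℝ) ≤ N := by positivity
      linarith
    rw [max_eq_right this, mul_zero]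

end Tail

end Urn

namespace Urn

/-! ### A strong law for martingale differences -/

section StrongLaw

open scoped ENNReal

/-- Kronecker's lemma for the weights `k + 1`. -/
theorem tendsto_average_of_tendsto_sum {d : ℕ → ℝ} {l : ℝ}
    (h : Tendsto (fun n => ∑ k ∈ Finset.range n, ((k : ℝ) + 1)⁻¹ * d k) atTop (𝓝 l)) :
    Tendsto (fun n : ℕ => (∑ k ∈ Finset.range n, d k) / n) atTop (𝓝 0) := by
  set S : ℕ → ℝ := fun n => ∑ k ∈ Finset.range n, ((k : ℝ) + 1)⁻¹ * d k with hS
  -- Summation by parts; after division by n it is the partial sum minus its own Cesàro mean.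
  have h1 : ∀ n : ℕ, ∑ k ∈ Finset.range n, d k = n * S n - ∑ k ∈ Finset.range n, S k := by
    intro n
    induction n with
    | zero => simp
    | succ n ih =>
      have hn : (n : ℝ) + 1 ≠ 0 := by positivity
      have e : S (n + 1) = S n + ((n : ℝ) + 1)⁻¹ * d n := Finset.sum_range_succ _ _
      rw [Finset.sum_range_succ, Finset.sum_range_succ, ih, e]
      push_cast
      field_simp
      ring
  have h2 := h.sub h.cesaro
  rw [sub_self] at h2
  refine h2.congr' ?_
  filter_upwards [eventually_gt_atTop 0] with n hn
  have hn' : (n : ℝ) ≠ 0 := by positivity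
  rw [h1]
  field_simp

variable {Ω : Type*} {m0 : MeasurableSpace Ω} {μ : Measure Ω}

/-- Finite expectation of ∑ |U_k|/(k + 1) gives almost sure absolute convergence, and Kronecker's
lemma concludes. No martingale structure is needed. -/
theorem ae_tendsto_average_of_tsum {U : ℕ → Ω → ℝ} (hU : ∀ k, AEStronglyMeasurable (U k) μ)
    (h : ∑' k : ℕ, ENNReal.ofReal ((k : ℝ) + 1)⁻¹ * eLpNorm (U k) 1 μ ≠ ∞) :
    ∀ᵐ ω ∂μ, Tendsto (fun n : ℕ => (∑ k ∈ Finset.range n, U k ω) / n) atTop (𝓝 0) := by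
  have hm : ∀ k : ℕ, AEMeasurable (fun ω => ENNReal.ofReal ((k : ℝ) + 1)⁻¹ * ‖U k ω‖ₑ) μ :=
    fun k => (hU k).enorm.const_mul _
  have h1 : ∫⁻ ω, ∑' k : ℕ, ENNReal.ofReal ((k : ℝ) + 1)⁻¹ * ‖U k ω‖ₑ ∂μ ≠ ∞ := by
    rw [lintegral_tsum hm]
    convert! h using 3 with k
    rw [lintegral_const_mul'' _ (hU k).enorm, eLpNorm_one_eq_lintegral_enorm]
  filter_upwards [ae_lt_top' (AEMeasurable.tsum hm) h1] with ω hω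
  have h2 : Summable fun k : ℕ => ((k : ℝ) + 1)⁻¹ * U k ω := by
    refine Summable.of_norm ?_
    have h3 : ∀ k : ℕ, ENNReal.ofReal ((k : ℝ) + 1)⁻¹ * ‖U k ω‖ₑ =
        ENNReal.ofReal ‖((k : ℝ) + 1)⁻¹ * U k ω‖ := fun k => by
      rw [norm_mul, Real.norm_of_nonneg (by positivity), ENNReal.ofReal_mul (by positivity),
        ofReal_norm]
    simp only [h3] at hω
    refine (ENNReal.summable_toReal hω.ne).congr fun k => ?_
    rw [ENNReal.toReal_ofReal (norm_nonneg _)]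
  exact tendsto_average_of_tendsto_sum h2.hasSum.tendsto_sum_nat

variable [IsProbabilityMeasure μ]

/-- Law of total variance, with the variance of the conditional mean dropped and the variance
bounded by the second moment. -/
theorem integral_sq_sub_condExp_le {m : MeasurableSpace Ω} (hm : m ≤ m0) {X : Ω → ℝ}
    (hX : MemLp X 2 μ) : ∫ ω, (X ω - (μ[X | m]) ω) ^ 2 ∂μ ≤ ∫ ω, X ω ^ 2 ∂μ := by
  have h1 := integral_condVar_add_variance_condExp hm hX
  have h2 := variance_nonneg (μ[X | m]) μ
  have h3 := variance_le_expectation_sq hX.1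
  have h4 : μ[Var[X; μ | m]] = ∫ ω, (X ω - (μ[X | m]) ω) ^ 2 ∂μ := by
    rw [condVar, integral_condExp hm]
    rfl
  rw [h4] at h1
  have h5 : ∫ ω, (X ^ 2) ω ∂μ = ∫ ω, X ω ^ 2 ∂μ := rfl
  linarith

/-- The weighted centered sums form a martingale with orthogonal increments, bounded in L² and hence
in L¹, so the martingale convergence theorem applies. -/
theorem ae_exists_tendsto_sum_centered (ℱ : Filtration ℕ m0) {T : ℕ → Ω → ℝ}
    (hT : ∀ k, StronglyMeasurable[ℱ (k + 1)] (T k)) (hT2 : ∀ k, MemLp (T k) 2 μ)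
    {w : ℕ → ℝ} {B : ℝ}
    (hB : ∀ n, ∑ k ∈ Finset.range n, w k ^ 2 * ∫ ω, T k ω ^ 2 ∂μ ≤ B) :
    ∀ᵐ ω ∂μ, ∃ l, Tendsto (fun n => ∑ k ∈ Finset.range n, w k * (T k ω - (μ[T k | ℱ k]) ω))
      atTop (𝓝 l) := by
  set D : ℕ → Ω → ℝ := fun k => T k - μ[T k | ℱ k] with hD
  have hDm : ∀ k, StronglyMeasurable[ℱ (k + 1)] (D k) := fun k =>
    (hT k).sub (stronglyMeasurable_condExp.mono (ℱ.mono k.le_succ))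
  have hD2 : ∀ k, MemLp (D k) 2 μ := fun k => (hT2 k).sub ((hT2 k).condExp one_le_two)
  have hD0 : ∀ k, μ[D k | ℱ k] =ᵐ[μ] 0 := fun k => by
    have h1 := condExp_sub ((hT2 k).integrable one_le_two) (integrable_condExp (μ := μ) (m := ℱ k)
      (f := T k)) (ℱ k)
    rw [condExp_of_stronglyMeasurable (ℱ.le k) stronglyMeasurable_condExp integrable_condExp,
      sub_self] at h1
    exact h1
  set S : ℕ → Ω → ℝ := fun n => ∑ k ∈ Finset.range n, w k • D k with hS
  have hSm : ∀ n, StronglyMeasurable[ℱ n] (S n) := fun n =>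
    Finset.stronglyMeasurable_sum _ fun k hk =>
      ((hDm k).mono (ℱ.mono (Finset.mem_range.1 hk))).const_smul _
  have hS2 : ∀ n, MemLp (S n) 2 μ := fun n => by
    have := memLp_finsetSum' (μ := μ) (p := 2) (Finset.range n) (f := fun k => w k • D k)
      fun k _ => (hD2 k).const_smul (w k)
    exact this
  have hsucc : ∀ n, S (n + 1) = S n + w n • D n := fun n => Finset.sum_range_succ _ _
  have hmart : Martingale S ℱ μ := by
    refine martingale_of_condExp_sub_eq_zero_nat hSm
      (fun n => (hS2 n).integrable one_le_two) fun n => ?_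
    rw [hsucc, add_sub_cancel_left]
    refine (condExp_smul (w n) (D n) (ℱ n)).trans ?_
    filter_upwards [hD0 n] with ω hω
    simp [hω]
  have horth : ∀ n, ∫ ω, S n ω * D n ω ∂μ = 0 := fun n => by
    have h1 : Integrable (S n * D n) μ := (hS2 n).integrable_mul (hD2 n)
    have h2 := condExp_mul_of_stronglyMeasurable_left (hSm n) h1 ((hD2 n).integrable one_le_two)
    have h3 : ∫ ω, (S n * D n) ω ∂μ = 0 := by
      rw [← integral_condExp (ℱ.le n), integral_congr_ae h2]
      refine integral_eq_zero_of_ae ?_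
      filter_upwards [hD0 n] with ω hω
      simp [hω]
    exact h3
  have hsq : ∀ n, ∫ ω, S n ω ^ 2 ∂μ ≤ ∑ k ∈ Finset.range n, w k ^ 2 * ∫ ω, T k ω ^ 2 ∂μ := by
    intro n
    induction n with
    | zero => simp [hS]
    | succ n ih =>
      rw [Finset.sum_range_succ]
      have e1 : ∀ ω, S (n + 1) ω ^ 2 =
          S n ω ^ 2 + (2 * w n) * (S n ω * D n ω) + w n ^ 2 * D n ω ^ 2 := fun ω => by
        rw [hsucc]
        simp only [Pi.add_apply, Pi.smul_apply, smul_eq_mul]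
        ring
      have i1 : Integrable (fun ω => S n ω ^ 2) μ := (hS2 n).integrable_sq
      have i2 : Integrable (fun ω => (2 * w n) * (S n ω * D n ω)) μ :=
        ((hS2 n).integrable_mul (hD2 n)).const_mul _
      have i3 : Integrable (fun ω => w n ^ 2 * D n ω ^ 2) μ := (hD2 n).integrable_sq.const_mul _
      simp only [e1]
      have i4 : Integrable (fun ω => S n ω ^ 2 + (2 * w n) * (S n ω * D n ω)) μ := i1.add i2
      rw [integral_add i4 i3, integral_add i1 i2, integral_const_mul, integral_const_mul,
        horth, mul_zero, add_zero]
      refine add_le_add ih (mul_le_mul_of_nonneg_left ?_ (sq_nonneg _))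
      exact integral_sq_sub_condExp_le (ℱ.le n) (hT2 n)
  have hbdd : ∀ n, eLpNorm (S n) 1 μ ≤ ((1 + B).toNNReal : ℝ≥0∞) := by
    intro n
    have i1 := (hS2 n).integrable one_le_two
    rw [eLpNorm_one_eq_lintegral_enorm, ← ofReal_integral_norm_eq_lintegral_enorm i1]
    refine ENNReal.ofReal_le_ofReal ?_
    -- |x| ≤ 1 + x² passes from the second moment to L¹.
    calc ∫ ω, ‖S n ω‖ ∂μ ≤ ∫ ω, (1 + S n ω ^ 2) ∂μ := by
          refine integral_mono i1.norm ((integrable_const _).add (hS2 n).integrable_sq) fun ω => ?_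
          simp only [Real.norm_eq_abs]
          nlinarith [sq_abs (S n ω), sq_nonneg (|S n ω| - 1)]
      _ = 1 + ∫ ω, S n ω ^ 2 ∂μ := by
          rw [integral_add (integrable_const _) (hS2 n).integrable_sq]
          simp
      _ ≤ 1 + B := by linarith [hsq n, hB n]
  filter_upwards [hmart.submartingale.ae_tendsto_limitProcess hbdd] with ω hω
  refine ⟨_, hω.congr fun n => ?_⟩
  simp [hS, hD]

/-- Strong law of large numbers for the increments of `Y` centered by their conditional means:
`Z` dominates `Y` and satisfies two summability conditions, which follow from an `L log L` bound. -/
theorem ae_tendsto_average_centered (ℱ : Filtration ℕ m0) {Y Z : ℕ → Ω → ℝ}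
    (hY : ∀ k, Measurable[ℱ (k + 1)] (Y k)) (hZ : ∀ k, Measurable[ℱ (k + 1)] (Z k))
    (hYZ : ∀ k ω, |Y k ω| ≤ Z k ω) (hZi : ∀ k, Integrable (Z k) μ)
    (h2 : ∑' k : ℕ, ∫⁻ ω, ENNReal.ofReal ((max (min (Z k ω) (k + 1)) 0) ^ 2 / ((k : ℝ) + 1) ^ 2) ∂μ
      ≠ ∞)
    (h1 : ∑' k : ℕ, ∫⁻ ω, ENNReal.ofReal (2 / ((k : ℝ) + 1) * max (Z k ω - (k + 1) / 2) 0) ∂μ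
      ≠ ∞) :
    ∀ᵐ ω ∂μ, Tendsto (fun n : ℕ => (∑ k ∈ Finset.range n, (Y k ω - (μ[Y k | ℱ k]) ω)) / n)
      atTop (𝓝 0) := by
  have hYi : ∀ k, Integrable (Y k) μ := fun k =>
    (hZi k).mono' ((hY k).mono (ℱ.le _) le_rfl).aestronglyMeasurable (ae_of_all _ (hYZ k))
  -- The truncation is decided by Z_k, not Y_k, so the domination hypotheses on Z bound both parts.
  set s : ℕ → Set Ω := fun k => {ω | Z k ω ≤ k + 1} with hs
  have hsm : ∀ k, MeasurableSet[ℱ (k + 1)] (s k) := fun k =>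
    hZ k (measurableSet_Iic (a := (k : ℝ) + 1))
  set T : ℕ → Ω → ℝ := fun k => (s k).indicator (Y k) with hT
  set U : ℕ → Ω → ℝ := fun k => (s k)ᶜ.indicator (Y k) with hU
  have hTm : ∀ k, Measurable[ℱ (k + 1)] (T k) := fun k => (hY k).indicator (hsm k)
  have hTb : ∀ k ω, |T k ω| ≤ max (min (Z k ω) (k + 1)) 0 := by
    intro k ω
    by_cases hω : ω ∈ s k
    · have hω' : Z k ω ≤ k + 1 := hω
      change |(s k).indicator (Y k) ω| ≤ _
      rw [Set.indicator_of_mem hω, min_eq_left hω']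
      exact (hYZ k ω).trans (le_max_left _ _)
    · change |(s k).indicator (Y k) ω| ≤ _
      rw [Set.indicator_of_notMem hω, abs_zero]
      exact le_max_right _ _
  have hT2 : ∀ k, MemLp (T k) 2 μ := fun k =>
    MemLp.of_bound ((hTm k).mono (ℱ.le _) le_rfl).aestronglyMeasurable (k + 1) <|
      ae_of_all _ fun ω => (hTb k ω).trans (max_le (min_le_right _ _) (by positivity))
  have hconv := ae_exists_tendsto_sum_centered ℱ (μ := μ) (fun k => (hTm k).stronglyMeasurable) hT2
    (w := fun k : ℕ => ((k : ℝ) + 1)⁻¹) (B := ENNReal.toReal _) (by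
      intro n
      rw [← ENNReal.ofReal_le_iff_le_toReal h2]
      rw [ENNReal.ofReal_sum_of_nonneg fun k _ =>
        mul_nonneg (sq_nonneg _) (integral_nonneg fun _ => sq_nonneg _)]
      refine le_trans (Finset.sum_le_sum fun k _ => ?_) (ENNReal.sum_le_tsum (Finset.range n))
      rw [← integral_const_mul, ofReal_integral_eq_lintegral_ofReal
        ((hT2 k).integrable_sq.const_mul _) (ae_of_all _ fun ω => by positivity)]
      refine lintegral_mono fun ω => ENNReal.ofReal_le_ofReal ?_
      rw [inv_pow, inv_mul_eq_div, ← sq_abs (T k ω)]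
      have := hTb k ω
      gcongr)
  have hUn : ∀ k : ℕ, ENNReal.ofReal ((k : ℝ) + 1)⁻¹ * eLpNorm (U k) 1 μ ≤
      ∫⁻ ω, ENNReal.ofReal (2 / ((k : ℝ) + 1) * max (Z k ω - (k + 1) / 2) 0) ∂μ := by
    intro k
    rw [eLpNorm_one_eq_lintegral_enorm, ← lintegral_const_mul' _ _ ENNReal.ofReal_ne_top]
    refine lintegral_mono fun ω => ?_
    rw [← ofReal_norm, ← ENNReal.ofReal_mul (by positivity)]
    refine ENNReal.ofReal_le_ofReal ?_
    rw [div_eq_inv_mul, mul_assoc]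
    refine mul_le_mul_of_nonneg_left ?_ (by positivity)
    by_cases hω : ω ∈ s k
    · change ‖(s k)ᶜ.indicator (Y k) ω‖ ≤ _
      rw [Set.indicator_of_notMem (by simpa using hω), norm_zero]
      positivity
    · have hω' : (k : ℝ) + 1 < Z k ω := not_le.1 hω
      change ‖(s k)ᶜ.indicator (Y k) ω‖ ≤ _
      rw [Set.indicator_of_mem (by simpa using hω), Real.norm_eq_abs]
      have := hYZ k ω
      have := le_max_left (Z k ω - ((k : ℝ) + 1) / 2) 0
      linarith
  have hUi : ∀ k, Integrable (U k) μ := fun k =>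
    (hYi k).indicator (ℱ.le _ _ (hsm k)).compl
  have hTi : ∀ k, Integrable (T k) μ := fun k => (hT2 k).integrable one_le_two
  have hU1 := ae_tendsto_average_of_tsum (μ := μ) (fun k => (hUi k).1)
    (ne_top_of_le_ne_top h1 (ENNReal.tsum_le_tsum hUn))
  -- Conditional expectation contracts L¹, so the conditional means of the remainders obey the same
  -- summable bound as the remainders.
  have hU2 := ae_tendsto_average_of_tsum (μ := μ) (U := fun k => μ[U k | ℱ k])
    (fun k => integrable_condExp.1)
    (ne_top_of_le_ne_top h1 (ENNReal.tsum_le_tsum fun k =>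
      (mul_le_mul_right (eLpNorm_condExp_le_eLpNorm _ le_rfl) _).trans (hUn k)))
  have hadd : ∀ᵐ ω ∂μ, ∀ k, (μ[Y k | ℱ k]) ω = (μ[T k | ℱ k]) ω + (μ[U k | ℱ k]) ω := by
    rw [ae_all_iff]
    intro k
    have e : Y k = T k + U k := (Set.indicator_self_add_compl (s k) (Y k)).symm
    rw [e]
    exact condExp_add (hTi k) (hUi k) (ℱ k)
  filter_upwards [hconv, hU1, hU2, hadd] with ω ⟨l, a1⟩ a2 a3 a4
  have a5 := ((tendsto_average_of_tendsto_sum a1).add a2).sub a3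
  rw [add_zero, sub_zero] at a5
  refine a5.congr fun n => ?_
  rw [← add_div, ← sub_div, ← Finset.sum_add_distrib, ← Finset.sum_sub_distrib]
  congr 1
  refine Finset.sum_congr rfl fun k _ => ?_
  have e : Y k ω = T k ω + U k ω :=
    (congrFun (Set.indicator_self_add_compl (s k) (Y k)) ω).symm
  rw [a4, e]
  ring

end StrongLaw

end Urn

namespace Urn

/-! ### Conditional independence -/

section CondIndep

variable {Ω α β : Type*} {m m0 : MeasurableSpace Ω} [MeasurableSpace α] [MeasurableSpace β]
  {P : Measure Ω} [IsProbabilityMeasure P] {X : Ω → α} {Y : Ω → β}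

/-- Conditional independence is stated for events, while replacement matrices are unbounded. For
fixed F in m, the event identity says that two finite measures on the range of Y coincide;
integrating g against both covers every integrable g(Y) at once. -/
theorem CondIndepGiven.condExp_indicator (hm : m ≤ m0) (h : CondIndepGiven P m X Y)
    (hX : Measurable X) (hY : Measurable Y) {A : Set α} (hA : MeasurableSet A) {g : β → ℝ}
    (hg : Measurable g) (hgi : Integrable (fun ω => g (Y ω)) P) :
    P[(X ⁻¹' A).indicator (fun ω => g (Y ω)) | m] =ᵐ[P]
      P⟦X ⁻¹' A | m⟧ * P[fun ω => g (Y ω) | m] := by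
  set q : Ω → ℝ := P⟦X ⁻¹' A | m⟧ with hq
  have hqm : StronglyMeasurable[m] q := stronglyMeasurable_condExp
  have hqm0 : Measurable q := (hqm.mono hm).measurable
  have hq0 : ∀ᵐ ω ∂P, 0 ≤ q ω :=
    condExp_nonneg (ae_of_all _ fun ω => Set.indicator_nonneg (fun _ _ => zero_le_one) ω)
  have hq1 : ∀ᵐ ω ∂P, |q ω| ≤ 1 :=
    ae_bdd_abs_condExp_of_ae_bdd_abs (ae_of_all _ fun ω => by
      by_cases hω : ω ∈ X ⁻¹' A <;> simp [hω])
  have hqmul : ∀ {f : Ω → ℝ}, Integrable f P → Integrable (q * f) P := fun hf =>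
    hf.bdd_mul hqm0.aestronglyMeasurable (hq1.mono fun ω hω => by simpa using hω)
  have hXA : MeasurableSet (X ⁻¹' A) := hX hA
  have hone : ∀ {s : Set Ω}, MeasurableSet s → Integrable (s.indicator fun _ => (1 : ℝ)) P :=
    fun hs => (integrable_const _).indicator hs
  have key : ∀ F, MeasurableSet[m] F →
      ∫ ω in F, (X ⁻¹' A).indicator (fun ω => g (Y ω)) ω ∂P = ∫ ω in F, q ω * g (Y ω) ∂P := by
    intro F hF
    have hF0 : MeasurableSet F := hm F hF
    -- Left: the law of Y on F ∩ {X ∈ A}. Right: its law on F under the density q = P(X ∈ A | m).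
    have hmeas : (P.restrict (F ∩ X ⁻¹' A)).map Y =
        ((P.restrict F).withDensity fun ω => ENNReal.ofReal (q ω)).map Y := by
      ext B hB
      have hYB : MeasurableSet (Y ⁻¹' B) := hY hB
      rw [Measure.map_apply hY hB, Measure.map_apply hY hB, Measure.restrict_apply hYB,
        withDensity_apply _ hYB, Measure.restrict_restrict hYB]
      have e1 : ∫ ω in F, (X ⁻¹' A ∩ Y ⁻¹' B).indicator (fun _ => (1 : ℝ)) ω ∂P =
          ∫ ω in F, q ω * (Y ⁻¹' B).indicator (fun _ => (1 : ℝ)) ω ∂P := by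
        rw [← setIntegral_condExp hm (hone (hXA.inter hYB)) hF]
        have h2 := condExp_mul_of_stronglyMeasurable_left hqm (hqmul (hone hYB)) (hone hYB)
        have h3 := setIntegral_condExp hm (hqmul (hone hYB)) hF
        refine Eq.trans ?_ h3
        refine setIntegral_congr_ae hF0 ?_
        filter_upwards [h A B hA hB, h2] with ω a1 a2 _
        rw [a1, a2]
      have e2 : ∫ ω in F, (X ⁻¹' A ∩ Y ⁻¹' B).indicator (fun _ => (1 : ℝ)) ω ∂P =
          P.real (Y ⁻¹' B ∩ (F ∩ X ⁻¹' A)) := by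
        rw [integral_indicator (hXA.inter hYB), Measure.restrict_restrict (hXA.inter hYB)]
        simp only [integral_const, smul_eq_mul, mul_one, measureReal_restrict_apply_univ]
        congr 1
        ext ω
        simp only [Set.mem_inter_iff]
        tauto
      have e3 : ∫ ω in F, q ω * (Y ⁻¹' B).indicator (fun _ => (1 : ℝ)) ω ∂P =
          ∫ ω in Y ⁻¹' B ∩ F, q ω ∂P := by
        rw [← Measure.restrict_restrict hYB, ← integral_indicator hYB]
        congr 1
        ext ω
        by_cases hω : ω ∈ Y ⁻¹' B <;> simp [hω]
      rw [← ofReal_integral_eq_lintegral_ofReal integrable_condExp.integrableOn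
        (ae_restrict_of_ae hq0), ← e3, ← e1, e2, ofReal_measureReal]
    have h1 : ∫ y, g y ∂((P.restrict (F ∩ X ⁻¹' A)).map Y) =
        ∫ ω in F, (X ⁻¹' A).indicator (fun ω => g (Y ω)) ω ∂P := by
      rw [integral_map hY.aemeasurable hg.aestronglyMeasurable, integral_indicator hXA,
        Measure.restrict_restrict hXA, Set.inter_comm]
    rw [← h1, hmeas, integral_map hY.aemeasurable hg.aestronglyMeasurable,
      integral_withDensity_eq_integral_toReal_smul hqm0.ennreal_ofReal
        (ae_of_all _ fun _ => ENNReal.ofReal_lt_top)]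
    refine integral_congr_ae ?_
    filter_upwards [ae_restrict_of_ae hq0] with ω hω
    rw [ENNReal.toReal_ofReal hω, smul_eq_mul]
  have h2 := condExp_mul_of_stronglyMeasurable_left hqm (hqmul hgi) hgi
  refine EventuallyEq.trans ?_ h2
  refine (ae_eq_condExp_of_forall_setIntegral_eq hm (hgi.indicator hXA)
    (fun s _ _ => integrable_condExp.integrableOn) (fun s hs _ => ?_)
    stronglyMeasurable_condExp.aestronglyMeasurable).symm
  rw [key s hs, setIntegral_condExp hm (hqmul hgi) hs]
  rfl

end CondIndep

/-! ### The urn process -/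

section UrnBasics

variable {Ω : Type*} {K : ℕ}

theorem abs_le_rowNorm (A : Matrix (Fin K) (Fin K) ℝ) (i j : Fin K) : |A i j| ≤ rowNorm A :=
  (Finset.single_le_sum (f := fun j => |A i j|) (fun _ _ => abs_nonneg _) (Finset.mem_univ j)).trans
    (le_ciSup (f := fun i => ∑ j, |A i j|) (Set.finite_range _).bddAbove i)

theorem measurable_rowNorm : Measurable (rowNorm : Matrix (Fin K) (Fin K) ℝ → ℝ) := by
  refine Measurable.iSup fun i => Finset.measurable_fun_sum _ fun j _ => ?_
  exact ((measurable_pi_apply j).comp (measurable_pi_apply i)).abs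

theorem measurable_matrix_entry (i j : Fin K) :
    Measurable fun A : Matrix (Fin K) (Fin K) ℝ => A i j :=
  (measurable_pi_apply j).comp (measurable_pi_apply i)

variable {C₀ : Ω → Fin K → ℝ} {R : ℕ → Ω → Matrix (Fin K) (Fin K) ℝ} {J : ℕ → Ω → Fin K}

theorem vecMul_chi (n : ℕ) (ω : Ω) (j : Fin K) :
    Matrix.vecMul (chi J n ω) (R n ω) j = R n ω (J n ω) j := by
  simp [chi]

theorem norm_vecMul_chi_le (n : ℕ) (ω : Ω) :
    ‖Matrix.vecMul (chi J n ω) (R n ω)‖ ≤ rowNorm (R n ω) := by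
  refine (pi_norm_le_iff_of_nonneg ?_).2 fun j => ?_
  · exact (abs_nonneg _).trans (abs_le_rowNorm (R n ω) (J n ω) (J n ω))
  · rw [vecMul_chi]
    exact abs_le_rowNorm _ _ _

theorem norm_chi_le (n : ℕ) (ω : Ω) : ‖chi J n ω‖ ≤ 1 := by
  refine (pi_norm_le_iff_of_nonneg zero_le_one).2 fun j => ?_
  by_cases h : j = J n ω
  · simp [chi, h]
  · simp [chi, h]

theorem comp_eq_add_sum (n : ℕ) (ω : Ω) :
    comp C₀ R J n ω = C₀ ω + ∑ k ∈ Finset.range n,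
      Matrix.vecMul (chi J (k + 1) ω) (R (k + 1) ω) := by
  induction n with
  | zero => simp [comp]
  | succ n ih => rw [Finset.sum_range_succ, ← add_assoc, ← ih]; rfl

theorem count_eq_sum (n : ℕ) (ω : Ω) :
    count J n ω = ∑ k ∈ Finset.range n, chi J (k + 1) ω := by
  induction n with
  | zero => simp [count]
  | succ n ih =>
    rw [Finset.sum_range_succ, ← ih, count, Finset.sum_Icc_succ_top (by omega)]
    rfl

theorem past_mono {m n : ℕ} (h : m ≤ n) : past C₀ R J m ≤ past C₀ R J n :=
  sup_le_sup_left (biSup_mono fun _ hk => ⟨hk.1, hk.2.trans h⟩) _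

theorem measurable_repl_past (n : ℕ) : Measurable[past C₀ R J (n + 1)] (R (n + 1)) :=
  Measurable.of_comap_le <| le_sup_of_le_right <|
    le_trans le_sup_left (le_biSup (fun m => MeasurableSpace.comap (R m) inferInstance ⊔
      MeasurableSpace.comap (chi J m) inferInstance) (Set.mem_Icc.2 ⟨by omega, le_rfl⟩))

theorem measurable_chi_past (n : ℕ) : Measurable[past C₀ R J (n + 1)] (chi J (n + 1)) :=
  Measurable.of_comap_le <| le_sup_of_le_right <|
    le_trans le_sup_right (le_biSup (fun m => MeasurableSpace.comap (R m) inferInstance ⊔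
      MeasurableSpace.comap (chi J m) inferInstance) (Set.mem_Icc.2 ⟨by omega, le_rfl⟩))

theorem measurable_vecMul {m : MeasurableSpace Ω} {x : Ω → Fin K → ℝ}
    {A : Ω → Matrix (Fin K) (Fin K) ℝ} (hx : Measurable x) (hA : Measurable A) :
    Measurable fun ω => Matrix.vecMul (x ω) (A ω) := by
  refine measurable_pi_lambda _ fun j => ?_
  simp only [Matrix.vecMul, dotProduct]
  refine Finset.measurable_fun_sum _ fun i _ => ?_
  exact ((measurable_pi_apply i).comp hx).mul ((measurable_matrix_entry i j).comp hA)

namespace IsUrn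

variable [MeasurableSpace Ω] {P : Measure Ω}

theorem measurable_chi (hurn : IsUrn P C₀ R J) (n : ℕ) : Measurable (chi J (n + 1)) :=
  (measurable_of_finite fun i : Fin K => (Pi.single i 1 : Fin K → ℝ)).comp
    (hurn.measurable_draw (n + 1) (by omega))

theorem past_le (hurn : IsUrn P C₀ R J) (n : ℕ) : past C₀ R J n ≤ ‹MeasurableSpace Ω› := by
  refine sup_le hurn.measurable_init.comap_le (iSup₂_le fun m hm => sup_le ?_ ?_)
  · exact (hurn.measurable_repl m hm.1).comap_le
  · obtain ⟨k, rfl⟩ := Nat.exists_eq_add_of_le' hm.1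
    exact (hurn.measurable_chi k).comap_le

/-- The filtration generated by the urn. -/
def filtration (hurn : IsUrn P C₀ R J) : Filtration ℕ ‹MeasurableSpace Ω› where
  seq := past C₀ R J
  mono' _ _ h := past_mono h
  le' := hurn.past_le

theorem measurable_comp (hurn : IsUrn P C₀ R J) (n : ℕ) : Measurable (comp C₀ R J n) := by
  induction n with
  | zero => exact hurn.measurable_init
  | succ n ih =>
    exact ih.add (measurable_vecMul (hurn.measurable_chi n)
      (hurn.measurable_repl (n + 1) (by omega)))

theorem measurable_total (hurn : IsUrn P C₀ R J) (n : ℕ) : Measurable (total C₀ R J n) :=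
  Finset.measurable_fun_sum _ fun i _ => (measurable_pi_apply i).comp (hurn.measurable_comp n)

theorem ae_comp_nonneg (hurn : IsUrn P C₀ R J) : ∀ᵐ ω ∂P, (∀ n i, 0 ≤ comp C₀ R J n ω i) ∧ ∀ n, 0 < total C₀ R J n ω := by
  have hR : ∀ᵐ ω ∂P, ∀ n i j, 0 ≤ R (n + 1) ω i j :=
    ae_all_iff.2 fun n => hurn.repl_nonneg (n + 1) (by omega)
  filter_upwards [hR, hurn.init_nonneg, hurn.init_ne_zero] with ω h1 h2 h3
  have hC : ∀ n i, 0 ≤ comp C₀ R J n ω i := fun n i => by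
    rw [comp_eq_add_sum, Pi.add_apply, Finset.sum_apply]
    exact add_nonneg (h2 i) (Finset.sum_nonneg fun k _ => by rw [vecMul_chi]; exact h1 k _ _)
  refine ⟨hC, fun n => ?_⟩
  obtain ⟨j, hj⟩ := Function.ne_iff.1 h3
  refine Finset.sum_pos' (fun i _ => hC n i) ⟨j, Finset.mem_univ _, ?_⟩
  rw [comp_eq_add_sum, Pi.add_apply, Finset.sum_apply]
  exact add_pos_of_pos_of_nonneg (lt_of_le_of_ne (h2 j) (Ne.symm hj))
    (Finset.sum_nonneg fun k _ => by rw [vecMul_chi]; exact h1 k _ _)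

theorem condExp_chi (hurn : IsUrn P C₀ R J) (n : ℕ) (i : Fin K) :
    P[fun ω => chi J (n + 1) ω i | past C₀ R J n] =ᵐ[P]
      fun ω => comp C₀ R J n ω i / total C₀ R J n ω := by
  convert! hurn.draw_prob n i using 2
  ext ω
  by_cases h : J (n + 1) ω = i
  · simp [chi, h]
  · have : chi J (n + 1) ω ≠ Pi.single i 1 := fun h' => by
      have := congrFun h' i
      simp [chi, Ne.symm h] at this
    rw [Set.indicator_of_notMem (by simpa using this)]
    simp [chi, Ne.symm h]

/-- Splitting by the drawn color writes entry j of χR as ∑_i 1{χ = e_i} R_ij; conditional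
independence factors each term into the draw probability and an entry of the generating matrix. -/
theorem condExp_vecMul [IsProbabilityMeasure P] (hurn : IsUrn P C₀ R J) (n : ℕ) (hRi : ∀ i j, Integrable (fun ω => R (n + 1) ω i j) P) (j : Fin K) :
    P[fun ω => Matrix.vecMul (chi J (n + 1) ω) (R (n + 1) ω) j | past C₀ R J n] =ᵐ[P]
      fun ω => ∑ i, comp C₀ R J n ω i / total C₀ R J n ω * genMatrix P C₀ R J n ω i j := by
  have hR := hurn.measurable_repl (n + 1) (by omega)
  have hset : ∀ i : Fin K, MeasurableSet (chi J (n + 1) ⁻¹' {Pi.single i 1}) := fun i =>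
    hurn.measurable_chi n (measurableSet_singleton _)
  have e : (fun ω => Matrix.vecMul (chi J (n + 1) ω) (R (n + 1) ω) j) =
      ∑ i, (chi J (n + 1) ⁻¹' {Pi.single i 1}).indicator fun ω => R (n + 1) ω i j := by
    ext ω
    rw [vecMul_chi, Finset.sum_apply, Finset.sum_eq_single (J (n + 1) ω)]
    · rw [Set.indicator_of_mem]
      simp [chi]
    · intro i _ hi
      rw [Set.indicator_of_notMem]
      intro h'
      have := congrFun (show chi J (n + 1) ω = Pi.single i 1 from h') i
      simp [chi, hi] at this
    · simp
  rw [e]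
  refine (condExp_finsetSum (fun i _ => (hRi i j).indicator (hset i)) _).trans ?_
  have h1 : ∀ i, P[(chi J (n + 1) ⁻¹' {Pi.single i 1}).indicator (fun ω => R (n + 1) ω i j) |
      past C₀ R J n] =ᵐ[P] fun ω => comp C₀ R J n ω i / total C₀ R J n ω *
        genMatrix P C₀ R J n ω i j := fun i => by
    have h2 := (hurn.condIndep n).condExp_indicator (hurn.past_le n) (hurn.measurable_chi n) hR
      (measurableSet_singleton (Pi.single i 1 : Fin K → ℝ)) (measurable_matrix_entry i j) (hRi i j)
    filter_upwards [h2, hurn.draw_prob n i] with ω a1 a2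
    rw [a1, Pi.mul_apply]
    exact congrArg₂ (· * ·) a2 rfl
  filter_upwards [ae_all_iff.2 h1] with ω hω
  rw [Finset.sum_apply]
  exact Finset.sum_congr rfl fun i _ => hω i

end IsUrn

end UrnBasics

end Urn

namespace Urn

/-! ### Convergence almost surely and in `L¹` -/

section Convergence

variable {Ω E : Type*} [MeasurableSpace Ω] {P : Measure Ω} [NormedAddCommGroup E]

theorem TendstoASL1.of_uniformIntegrable [IsFiniteMeasure P] {X : ℕ → Ω → E} {Y : Ω → E}
    (hX : UniformIntegrable X 1 P)
    (h : ∀ᵐ ω ∂P, Tendsto (fun n => X n ω) atTop (𝓝 (Y ω))) : TendstoASL1 P X Y := by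
  have hY : MemLp Y 1 P := hX.memLp_of_ae_tendsto h
  exact ⟨h, hX.memLp, hY, tendsto_Lp_finite_of_tendsto_ae le_rfl ENNReal.one_ne_top
    (fun n => (hX.memLp n).1) hY hX.2.1 h⟩

theorem TendstoASL1.of_dominated {X : ℕ → Ω → E} {Y : Ω → E} {b : Ω → ℝ} (hb : Integrable b P)
    (hX : ∀ n, AEStronglyMeasurable (X n) P) (hXb : ∀ n, ∀ᵐ ω ∂P, ‖X n ω‖ ≤ b ω)
    (h : ∀ᵐ ω ∂P, Tendsto (fun n => X n ω) atTop (𝓝 (Y ω))) : TendstoASL1 P X Y := by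
  have hY : AEStronglyMeasurable Y P := aestronglyMeasurable_of_tendsto_ae atTop hX h
  have hYb : ∀ᵐ ω ∂P, ‖Y ω‖ ≤ b ω := by
    filter_upwards [h, ae_all_iff.2 hXb] with ω h1 h2
    exact le_of_tendsto h1.norm (Eventually.of_forall h2)
  refine ⟨h, fun n => memLp_one_iff_integrable.2 (hb.mono' (hX n) (hXb n)),
    memLp_one_iff_integrable.2 (hb.mono' hY hYb), ?_⟩
  have := tendsto_lintegral_norm_of_dominated_convergence hX hb.2 hXb h
  refine this.congr fun n => ?_
  rw [eLpNorm_one_eq_lintegral_enorm]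
  simp only [ofReal_norm, Pi.sub_apply]

theorem TendstoASL1.add {X X' : ℕ → Ω → E} {Y Y' : Ω → E} (h : TendstoASL1 P X Y)
    (h' : TendstoASL1 P X' Y') : TendstoASL1 P (fun n => X n + X' n) (Y + Y') := by
  refine ⟨?_, fun n => (h.memLp n).add (h'.memLp n), h.memLp_limit.add h'.memLp_limit, ?_⟩
  · filter_upwards [h.ae_tendsto, h'.ae_tendsto] with ω h1 h2
    exact h1.add h2
  · have := h.tendsto_L1.add h'.tendsto_L1
    rw [add_zero] at this
    refine tendsto_of_tendsto_of_tendsto_of_le_of_le tendsto_const_nhds this (fun n => zero_le)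
      fun n => ?_
    simp only [add_sub_add_comm]
    exact eLpNorm_add_le ((h.memLp n).sub h.memLp_limit).1 ((h'.memLp n).sub h'.memLp_limit).1
      le_rfl

theorem TendstoASL1.clm_comp {F : Type*} [NormedAddCommGroup F] [NormedSpace ℝ E] [NormedSpace ℝ F]
    (L : E →L[ℝ] F) {X : ℕ → Ω → E} {Y : Ω → E} (h : TendstoASL1 P X Y) :
    TendstoASL1 P (fun n ω => L (X n ω)) (fun ω => L (Y ω)) := by
  refine ⟨?_, fun n => L.comp_memLp' (h.memLp n), L.comp_memLp' h.memLp_limit, ?_⟩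
  · filter_upwards [h.ae_tendsto] with ω h1
    exact (L.continuous.tendsto _).comp h1
  · have := ENNReal.Tendsto.const_mul (a := ENNReal.ofReal ‖L‖) h.tendsto_L1
      (Or.inr ENNReal.ofReal_ne_top)
    rw [mul_zero] at this
    refine tendsto_of_tendsto_of_tendsto_of_le_of_le tendsto_const_nhds this (fun n => zero_le)
      fun n => ?_
    refine eLpNorm_le_mul_eLpNorm_of_ae_le_mul (ae_of_all _ fun ω => ?_) 1
    simp only [Pi.sub_apply, ← map_sub]
    exact L.le_opNorm _

theorem TendstoASL1.congr {X X' : ℕ → Ω → E} {Y Y' : Ω → E} (h : TendstoASL1 P X Y)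
    (hX : ∀ n, X n = X' n) (hY : Y =ᵐ[P] Y') : TendstoASL1 P X' Y' := by
  obtain rfl : X = X' := funext hX
  refine ⟨?_, h.memLp, (memLp_congr_ae hY).1 h.memLp_limit, h.tendsto_L1.congr fun n => ?_⟩
  · filter_upwards [h.ae_tendsto, hY] with ω h1 h2
    rwa [← h2]
  · exact eLpNorm_congr_ae (EventuallyEq.rfl.sub hY)

end Convergence

/-! ### Convergence of the urn -/

section Main

variable {Ω Ω' : Type*} [MeasurableSpace Ω] [MeasurableSpace Ω'] {P : Measure Ω}
  {P' : Measure Ω'} {K : ℕ}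
  {C₀ : Ω → Fin K → ℝ} {R : ℕ → Ω → Matrix (Fin K) (Fin K) ℝ} {J : ℕ → Ω → Fin K}

theorem tailLE_of_measureReal_le [IsFiniteMeasure P] [IsFiniteMeasure P'] {c : ℝ} (hc : 0 < c) {Z : Ω → ℝ} {M : Ω' → ℝ}
    (h : ∀ x : ℝ, 0 < x → P.real {ω | x < Z ω} ≤ c * P'.real {ω | x < M ω}) :
    TailLE P P' (ENNReal.ofReal c) Z M := fun x hx => by
  have := ENNReal.ofReal_le_ofReal (h x hx)
  rwa [ENNReal.ofReal_mul hc.le, ofReal_measureReal, ofReal_measureReal] at this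

theorem abs_sum_mul_le_rowNorm {x : Fin K → ℝ} (hx : ∀ i, 0 ≤ x i) (hx1 : ∑ i, x i = 1)
    (A : Matrix (Fin K) (Fin K) ℝ) (j : Fin K) : |∑ i, x i * A i j| ≤ rowNorm A := by
  calc |∑ i, x i * A i j| ≤ ∑ i, |x i * A i j| := Finset.abs_sum_le_sum_abs _ _
    _ ≤ ∑ i, x i * rowNorm A := Finset.sum_le_sum fun i _ => by
        rw [abs_mul, abs_of_nonneg (hx i)]
        exact mul_le_mul_of_nonneg_left (abs_le_rowNorm A i j) (hx i)
    _ = rowNorm A := by rw [← Finset.sum_mul, hx1, one_mul]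

namespace IsUrn

theorem ae_tendsto_count_sub [IsProbabilityMeasure P] (hurn : IsUrn P C₀ R J) (i : Fin K) :
    ∀ᵐ ω ∂P, Tendsto (fun n : ℕ => (∑ k ∈ Finset.range n,
      (chi J (k + 1) ω i - comp C₀ R J k ω i / total C₀ R J k ω)) / n) atTop (𝓝 0) := by
  -- The indicators are bounded, so the constant 1 serves as both dominating and majorizing
  -- variable.
  have hT : ∀ _ : ℕ, TailLE P P 1 (fun _ => (1 : ℝ)) (fun _ => (1 : ℝ)) := fun _ x _ => by simp
  have h := ae_tendsto_average_centered (μ := P) hurn.filtration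
    (Y := fun k ω => chi J (k + 1) ω i) (Z := fun _ _ => 1)
    (fun k => (measurable_pi_apply i).comp (measurable_chi_past k)) (fun k => measurable_const)
    (fun k ω => (norm_le_pi_norm (chi J (k + 1) ω) i).trans (norm_chi_le _ _))
    (fun k => integrable_const _)
    (tsum_lintegral_min_sq_ne_top hT ENNReal.one_ne_top (fun _ => aemeasurable_const)
      (integrable_const _) (ae_of_all _ fun _ => one_pos))
    (tsum_lintegral_posPart_ne_top hT ENNReal.one_ne_top (fun _ => aemeasurable_const)
      (integrable_const _) (ae_of_all _ fun _ => one_pos) (integrable_const _))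
  filter_upwards [h, ae_all_iff.2 fun k => hurn.condExp_chi k i] with ω h1 h2
  refine h1.congr fun n => ?_
  congr 1
  refine Finset.sum_congr rfl fun k _ => ?_
  rw [← h2 k]
  rfl

variable {c : ℝ} {M : Ω' → ℝ}

theorem integrable_repl_entry (hurn : IsUrn P C₀ R J)
    (hT : ∀ k, TailLE P P' (ENNReal.ofReal c) (fun ω => rowNorm (R (k + 1) ω)) M)
    (hM : Integrable M P') (k : ℕ) :
    Integrable (fun ω => rowNorm (R (k + 1) ω)) P ∧
      ∀ i j, Integrable (fun ω => R (k + 1) ω i j) P := by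
  have hR := hurn.measurable_repl (k + 1) (by omega)
  have h1 : Integrable (fun ω => rowNorm (R (k + 1) ω)) P :=
    (hT k).integrable ENNReal.ofReal_ne_top (measurable_rowNorm.comp hR).aemeasurable
      (fun ω => (norm_nonneg _).trans (norm_vecMul_chi_le (J := J) (k + 1) ω)) hM
  exact ⟨h1, fun i j => h1.mono' ((measurable_matrix_entry i j).comp hR).aestronglyMeasurable
    (ae_of_all _ fun ω => abs_le_rowNorm _ i j)⟩

theorem ae_tendsto_comp_sub [IsProbabilityMeasure P] (hurn : IsUrn P C₀ R J)
    (hT : ∀ k, TailLE P P' (ENNReal.ofReal c) (fun ω => rowNorm (R (k + 1) ω)) M)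
    (hMpos : ∀ᵐ ω ∂P', 0 < M ω) (hM : Integrable M P')
    (hMlog : Integrable (fun ω => M ω * Real.posLog (M ω)) P') (j : Fin K) :
    ∀ᵐ ω ∂P, Tendsto (fun n : ℕ => (∑ k ∈ Finset.range n,
      (Matrix.vecMul (chi J (k + 1) ω) (R (k + 1) ω) j -
        ∑ i, comp C₀ R J k ω i / total C₀ R J k ω * genMatrix P C₀ R J k ω i j)) / n)
      atTop (𝓝 0) := by
  have hint := fun k => hurn.integrable_repl_entry hT hM k
  have hZm : ∀ k, AEMeasurable (fun ω => rowNorm (R (k + 1) ω)) P := fun k =>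
    (hint k).1.aemeasurable
  have h := ae_tendsto_average_centered (μ := P) hurn.filtration
    (Y := fun k ω => Matrix.vecMul (chi J (k + 1) ω) (R (k + 1) ω) j)
    (Z := fun k ω => rowNorm (R (k + 1) ω))
    (fun k => (measurable_pi_apply j).comp
      (measurable_vecMul (measurable_chi_past k) (measurable_repl_past k)))
    (fun k => measurable_rowNorm.comp (measurable_repl_past k))
    (fun k ω => (norm_le_pi_norm (Matrix.vecMul (chi J (k + 1) ω) (R (k + 1) ω)) j).trans
      (norm_vecMul_chi_le _ _))
    (fun k => (hint k).1)
    (tsum_lintegral_min_sq_ne_top hT ENNReal.ofReal_ne_top hZm hM hMpos)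
    (tsum_lintegral_posPart_ne_top hT ENNReal.ofReal_ne_top hZm hM hMpos hMlog)
  filter_upwards [h, ae_all_iff.2 fun k => hurn.condExp_vecMul k (hint k).2 j] with ω h1 h2
  refine h1.congr fun n => ?_
  congr 1
  refine Finset.sum_congr rfl fun k _ => ?_
  rw [← h2 k]
  rfl

theorem ae_tendsto_perron [IsProbabilityMeasure P] (hurn : IsUrn P C₀ R J)
    (hT : ∀ k, TailLE P P' (ENNReal.ofReal c) (fun ω => rowNorm (R (k + 1) ω)) M)
    (hMpos : ∀ᵐ ω ∂P', 0 < M ω) (hM : Integrable M P')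
    (hMlog : Integrable (fun ω => M ω * Real.posLog (M ω)) P')
    {H : Ω → Matrix (Fin K) (Fin K) ℝ} (hirr : ∀ᵐ ω ∂P, (H ω).IsIrreducible)
    (hces : ∀ᵐ ω ∂P, Tendsto (fun n : ℕ =>
      (1 / (n : ℝ)) * ∑ k ∈ Finset.range n, rowNorm (genMatrix P C₀ R J k ω - H ω))
      atTop (𝓝 0)) :
    ∀ᵐ ω ∂P, ∃ r p v, PerronData (H ω) r p v ∧
      (∀ i, Tendsto (fun n : ℕ => comp C₀ R J n ω i / n) atTop (𝓝 (r * p i))) ∧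
      (∀ i, Tendsto (fun n => comp C₀ R J n ω i / total C₀ R J n ω) atTop (𝓝 (p i))) ∧
      ∀ i, Tendsto (fun n : ℕ => count J n ω i / n) atTop (𝓝 (p i)) := by
  filter_upwards [hirr, hces, hurn.ae_comp_nonneg,
    ae_all_iff.2 (hurn.ae_tendsto_comp_sub hT hMpos hM hMlog),
    ae_all_iff.2 hurn.ae_tendsto_count_sub] with ω h1 h2 ⟨h3, h4⟩ h5 h6
  -- `J 0` records no draw; its value merely witnesses that there is a color.
  have hne : Nonempty (Fin K) := ⟨J 0 ω⟩
  obtain ⟨r, p, v, hp⟩ := exists_perronData h1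
  set x : ℕ → Fin K → ℝ := fun n i => comp C₀ R J n ω i / total C₀ R J n ω with hx
  have hx0 : ∀ n i, 0 ≤ x n i := fun n i => div_nonneg (h3 n i) (h4 n).le
  have hx1 : ∀ n, ∑ i, x n i = 1 := fun n => by
    simp only [hx]
    rw [← Finset.sum_div]
    exact div_self (h4 n).ne'
  have hlim : ∀ j, Tendsto (fun n : ℕ => comp C₀ R J n ω j / n -
      (∑ k ∈ Finset.range n, ∑ i, x k i * H ω i j) / n) atTop (𝓝 0) := by
    intro j
    have e1 : Tendsto (fun n : ℕ => C₀ ω j / n) atTop (𝓝 0) := tendsto_const_div_atTop_nhds_zero_nat _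
    -- Because x_k is a probability vector, replacing H_k by H costs at most the row norm of the
    -- difference, which the Cesàro hypothesis averages out.
    have e2 : Tendsto (fun n : ℕ => (∑ k ∈ Finset.range n,
        ∑ i, x k i * (genMatrix P C₀ R J k ω - H ω) i j) / n) atTop (𝓝 0) := by
      refine squeeze_zero_norm (fun n => ?_) h2
      rw [norm_div, Real.norm_natCast, one_div, inv_mul_eq_div]
      refine div_le_div_of_nonneg_right ((norm_sum_le _ _).trans
        (Finset.sum_le_sum fun k _ => ?_)) (Nat.cast_nonneg n)
      exact abs_sum_mul_le_rowNorm (hx0 k) (hx1 k) _ j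
    have e3 := (e1.add (h5 j)).add e2
    rw [add_zero, add_zero] at e3
    refine e3.congr fun n => ?_
    rw [comp_eq_add_sum, Pi.add_apply, Finset.sum_apply, ← add_div, ← add_div, ← sub_div]
    congr 1
    rw [add_assoc, ← Finset.sum_add_distrib, add_sub_assoc, ← Finset.sum_sub_distrib]
    congr 1
    refine Finset.sum_congr rfl fun k _ => ?_
    simp only [Matrix.sub_apply, mul_sub, Finset.sum_sub_distrib]
    ring
  obtain ⟨g1, g2, g3⟩ := hp.tendsto_proportions hx0 hx1 h4 (fun n i => rfl) hlim
  refine ⟨r, p, v, hp, g1, g2, fun i => ?_⟩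
  have := (h6 i).add (g3 i)
  rw [zero_add] at this
  refine this.congr fun n => ?_
  rw [← add_div, ← Finset.sum_add_distrib, count_eq_sum, Finset.sum_apply]
  congr 1
  exact Finset.sum_congr rfl fun k _ => by simp only [hx]; ring

end IsUrn

end Main

end Urn

/-! ### Assembly: almost sure limits and the passage to L¹ -/

theorem mainTheorem3
    {Ω Ω' : Type*} [MeasurableSpace Ω] [MeasurableSpace Ω']
    (P : Measure Ω) [IsProbabilityMeasure P] (P' : Measure Ω') [IsProbabilityMeasure P']
    (K : ℕ) (C₀ : Ω → Fin K → ℝ) (R : ℕ → Ω → Matrix (Fin K) (Fin K) ℝ) (J : ℕ → Ω → Fin K)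
    (hurn : Urn.IsUrn P C₀ R J)
    -- majorization, with a positive majorizing variable satisfying an `L log₊ L` condition
    (c : ℝ) (hc : 0 < c) (M : Ω' → ℝ) (hMpos : ∀ᵐ ω ∂P', 0 < M ω) (hM : Integrable M P')
    (hmaj : ∀ n : ℕ, 1 ≤ n → ∀ x : ℝ, 0 < x →
      P.real {ω | x < Urn.rowNorm (R n ω)} ≤ c * P'.real {ω | x < M ω})
    (hMlog : Integrable (fun ω => M ω * Real.posLog (M ω)) P')
    -- Cesàro convergence of the generating matrices to an almost surely irreducible matrix
    (H : Ω → Matrix (Fin K) (Fin K) ℝ) (hH : Measurable H)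
    (hirr : ∀ᵐ ω ∂P, (H ω).IsIrreducible)
    (hces : ∀ᵐ ω ∂P, Tendsto (fun n : ℕ =>
      (1 / (n : ℝ)) * ∑ k ∈ Finset.range n, Urn.rowNorm (Urn.genMatrix P C₀ R J k ω - H ω))
      atTop (𝓝 0)) :
    (∀ᵐ ω ∂P, ∃! v, Urn.IsPerronVector (H ω) v) ∧
    Urn.TendstoASL1 P (fun n ω => (Urn.total C₀ R J n ω)⁻¹ • Urn.comp C₀ R J n ω)
      (fun ω => Urn.perronVector (H ω)) ∧
    Urn.TendstoASL1 P (fun n ω => Urn.total C₀ R J n ω / (n : ℝ))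
      (fun ω => Urn.domEigenvalue (H ω)) ∧
    Urn.TendstoASL1 P (fun n ω => (n : ℝ)⁻¹ • Urn.comp C₀ R J n ω)
      (fun ω => Urn.domEigenvalue (H ω) • Urn.perronVector (H ω)) ∧
    Urn.TendstoASL1 P (fun n ω => (n : ℝ)⁻¹ • Urn.count J n ω)
      (fun ω => Urn.perronVector (H ω)) := by
  have hT : ∀ k, Urn.TailLE P P' (ENNReal.ofReal c) (fun ω => Urn.rowNorm (R (k + 1) ω)) M :=
    fun k => Urn.tailLE_of_measureReal_le hc (hmaj (k + 1) (by omega))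
  have hmain := hurn.ae_tendsto_perron hT hMpos hM hMlog hirr hces
  have hcomp : ∀ᵐ ω ∂P, Tendsto (fun n : ℕ => (n : ℝ)⁻¹ • Urn.comp C₀ R J n ω) atTop
      (𝓝 (Urn.domEigenvalue (H ω) • Urn.perronVector (H ω))) := by
    filter_upwards [hmain] with ω ⟨r, p, v, hp, g1, _, _⟩
    rw [hp.domEigenvalue_eq, hp.perronVector_eq, tendsto_pi_nhds]
    exact fun i => (g1 i).congr fun n => div_eq_inv_mul _ _
  -- |C₀| dominates for every n, including n = 0, where the inverse is 0.
  have hC₀ : Urn.TendstoASL1 P (fun (n : ℕ) ω => (n : ℝ)⁻¹ • C₀ ω) (fun _ => 0) := by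
    refine Urn.TendstoASL1.of_dominated hurn.init_integrable.norm
      (fun n => hurn.init_integrable.1.const_smul ((n : ℝ)⁻¹)) (fun n => ae_of_all _ fun ω => ?_)
      (ae_of_all _ fun ω => ?_)
    · rw [norm_smul, norm_inv, Real.norm_natCast]
      exact mul_le_of_le_one_left (norm_nonneg _) (Nat.cast_inv_le_one n)
    · simpa using (tendsto_natCast_atTop_atTop (R := ℝ)).inv_tendsto_atTop.smul_const (C₀ ω)
  have hL : Urn.TendstoASL1 P (fun (n : ℕ) ω => (n : ℝ)⁻¹ • Urn.comp C₀ R J n ω)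
      (fun ω => Urn.domEigenvalue (H ω) • Urn.perronVector (H ω)) := by
    -- The increments inherit uniform integrability from the common tail bound, and averaging
    -- preserves it. The initial composition is treated separately, as it is merely integrable.
    have hUI : UniformIntegrable
        (fun k ω => Matrix.vecMul (Urn.chi J (k + 1) ω) (R (k + 1) ω)) 1 P :=
      Urn.uniformIntegrable_of_tailLE hT ENNReal.ofReal_ne_top
        (fun k => (hurn.integrable_repl_entry hT hM k).1.aemeasurable) hM
        (fun k => (Urn.measurable_vecMul (hurn.measurable_chi k)
          (hurn.measurable_repl (k + 1) (by omega))).aestronglyMeasurable)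
        (fun k ω => Urn.norm_vecMul_chi_le _ _)
    have hsplit : ∀ (n : ℕ) (ω : Ω), (n : ℝ)⁻¹ • Urn.comp C₀ R J n ω = (n : ℝ)⁻¹ • C₀ ω +
        ((n : ℝ)⁻¹ • ∑ k ∈ Finset.range n,
          fun ω => Matrix.vecMul (Urn.chi J (k + 1) ω) (R (k + 1) ω)) ω := fun n ω => by
      rw [Urn.comp_eq_add_sum, smul_add, Pi.smul_apply, Finset.sum_apply]
    refine (hC₀.add (Urn.TendstoASL1.of_uniformIntegrable (uniformIntegrable_average le_rfl hUI)
      (Y := fun ω => Urn.domEigenvalue (H ω) • Urn.perronVector (H ω)) ?_)).congr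
      (fun n => ?_) ?_
    · filter_upwards [hcomp, hC₀.ae_tendsto] with ω h1 h2
      have := h1.sub h2
      rw [sub_zero] at this
      refine this.congr fun n => ?_
      rw [hsplit, add_sub_cancel_left]
    · ext1 ω
      exact (hsplit n ω).symm
    · exact ae_of_all _ fun ω => zero_add _
  refine ⟨?_, ?_, ?_, hL, ?_⟩
  · filter_upwards [hmain] with ω ⟨r, p, v, hp, _⟩
    exact ⟨p, hp.isPerronVector, fun w hw => hp.isPerronVector_unique hw⟩
  · refine Urn.TendstoASL1.of_dominated (b := fun _ => 1) (integrable_const _) (fun n => ?_)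
      (fun n => ?_) ?_
    · exact ((hurn.measurable_total n).inv.smul (hurn.measurable_comp n)).aestronglyMeasurable
    · filter_upwards [hurn.ae_comp_nonneg] with ω ⟨h1, h2⟩
      refine (pi_norm_le_iff_of_nonneg zero_le_one).2 fun i => ?_
      rw [Pi.smul_apply, smul_eq_mul, inv_mul_eq_div,
        Real.norm_of_nonneg (div_nonneg (h1 n i) (h2 n).le), div_le_one (h2 n)]
      exact Finset.single_le_sum (fun j _ => h1 n j) (Finset.mem_univ i)
    · filter_upwards [hmain] with ω ⟨r, p, v, hp, _, g2, _⟩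
      rw [hp.perronVector_eq, tendsto_pi_nhds]
      exact fun i => (g2 i).congr fun n => div_eq_inv_mul _ _
  -- S_n/n is the image of C_n/n under the sum-of-coordinates functional, which sends λ_H π_H to
  -- λ_H.
  · refine (hL.clm_comp (∑ i : Fin K, ContinuousLinearMap.proj (R := ℝ)
      (φ := fun _ : Fin K => ℝ) i)).congr (fun n => ?_) ?_
    · ext1 ω
      simp only [_root_.sum_apply, ContinuousLinearMap.proj_apply, Pi.smul_apply,
        smul_eq_mul, ← Finset.mul_sum, Urn.total, div_eq_inv_mul]
    · filter_upwards [hmain] with ω ⟨r, p, v, hp, _⟩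
      simp only [_root_.sum_apply, ContinuousLinearMap.proj_apply, Pi.smul_apply,
        smul_eq_mul, ← Finset.mul_sum]
      rw [hp.perronVector_eq, hp.p_sum, mul_one]
  · refine Urn.TendstoASL1.of_dominated (b := fun _ => 1) (integrable_const _) (fun n => ?_)
      (fun n => ae_of_all _ fun ω => ?_) ?_
    · simp only [Urn.count_eq_sum]
      exact ((Finset.measurable_fun_sum _ fun k _ =>
        hurn.measurable_chi k).const_smul ((n : ℝ)⁻¹)).aestronglyMeasurable
    · rw [norm_smul, norm_inv, Real.norm_natCast, Urn.count_eq_sum]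
      refine inv_mul_le_one_of_le₀ ?_ (Nat.cast_nonneg n)
      refine (norm_sum_le_of_le _ fun k _ => Urn.norm_chi_le (k + 1) ω).trans ?_
      simp
    · filter_upwards [hmain] with ω ⟨r, p, v, hp, _, _, g3⟩
      rw [hp.perronVector_eq, tendsto_pi_nhds]
      exact fun i => (g3 i).congr fun n => div_eq_inv_mul _ _
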